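/- Let $n\ge 0$ and $k\ge 1$ be integers, let $x_1,\dots,x_n$ be indeterminates over a field $F$, and let $q\in F$ be a parameter with $q^m\neq 1$ for $1\le m\le n$ (for instance $F=\mathbb{Q}(q)$ with $q$ an indeterminate). Write $(a;q)_m=\prod_{i=1}^{m}(1-aq^{i-1})$ and $(q)_m=(q;q)_m$. For a partition $\lambda=(\lambda_1\ge\dots\ge\lambda_n\ge 0)$ of length at most $n$, let $m_i(\lambda)$ be the number of indices $j\in\{1,\dots,n\}$ with $\lambda_j=i$ ($i\ge 0$), let $\lambda'$ be the conjugate partition, with parts $\lambda'_j=\#\{i:\lambda_i\ge j\}$ for $j\ge 1$, and let $$P_\lambda(X,q)=\prod_{i\ge 0}\frac{(1-q)^{m_i(\lambda)}}{(q)_{m_i(\lambda)}}\sum_{w\in S_n}w\Bigl(x_1^{\lambda_1}\cdots x_n^{\lambda_n}\prod_{i<j}\frac{x_i-qx_j}{x_i-x_j}\Bigr)$$ be the Hall–Littlewood polynomial, where $S_n$ acts by permuting the indeterminates. Put $$\Phi_q(X;\alpha,\beta)=\prod_i\frac{1-\alpha x_i}{1-\beta x_i}\prod_{i<j}\frac{1-qx_ix_j}{1-x_ix_j},$$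 and for $\xi\in\{\pm1\}^n$ let $X^\xi=(x_1^{\xi_1},\dots,x_n^{\xi_n})$ and let $|\xi|_{-1}$ be the number of $i$ with $\xi_i=-1$. Then the following identities hold in $F(x_1,\dots,x_n)$, where the sums on the left run over partitions $\lambda$ of length at most $n$ and "$\lambda'$ even" means that all parts of $\lambda'$ are even: $$\sum_{\lambda_1\le k,\ \lambda'\text{ even}}c_{\lambda,k}(q)\,P_\lambda(X,q)=\sum_{\xi\in\{\pm1\}^n,\ |\xi|_{-1}\text{ even}}\Phi_q(X^\xi;0,0)\prod_i x_i^{k(1-\xi_i)/2},$$ $$\sum_{\lambda_1\le k}d_{\lambda,k}(q)\,P_\lambda(X,q)=\sum_{\xi\in\{\pm1\}^n}\Phi_q(X^\xi;q,1)\prod_i x_i^{k(1-\xi_i)/2},$$ where $$c_{\lambda,k}(q)=\prod_{i=1}^{k-1}(q;q^2)_{m_i(\lambda)/2},\qquad d_{\lambda,k}(q)=\prod_{i=1}^{k-1}\frac{(q)_{m_i(\lambda)}}{(q^2;q^2)_{\lfloor m_i(\lambda)/2\rfloor}}.$$ -/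

import Mathlib

namespace HallLittlewood

/-- The `q`-shifted factorial `(a; q)_m = ∏_{i=1}^{m} (1 - a q^{i-1})`. -/
def qPoch {K : Type*} [Field K] (a q : K) (m : ℕ) : K :=
  ∏ i ∈ Finset.range m, (1 - a * q ^ i)

/-- The multiplicity `m_i(λ)` of `i` among the entries of `λ = (λ_1, …, λ_n)`
(for `i = 0` this counts the zero entries). -/
def mult {n : ℕ} (l : Fin n → ℕ) (i : ℕ) : ℕ :=
  (Finset.univ.filter (fun j : Fin n => l j = i)).card

/-- The part `λ'_j` of the conjugate partition: the number of parts of `λ` that are at least `j`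
(meaningful for `j ≥ 1`). -/
def conjPart {n : ℕ} (l : Fin n → ℕ) (j : ℕ) : ℕ :=
  (Finset.univ.filter (fun i : Fin n => j ≤ l i)).card

open Classical in
/-- The partitions `λ = (λ_1 ≥ … ≥ λ_n ≥ 0)` of length at most `n` with `λ_1 ≤ k`. -/
noncomputable def boundedPartitions (n k : ℕ) : Finset (Fin n → ℕ) :=
  (Fintype.piFinset (fun _ : Fin n => Finset.range (k + 1))).filter (fun l => Antitone l)

open Classical in
/-- The partitions in `boundedPartitions n k` whose conjugate has only even parts. -/
noncomputable def boundedConjEvenPartitions (n k : ℕ) : Finset (Fin n → ℕ) :=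
  (boundedPartitions n k).filter (fun l => ∀ j : ℕ, 1 ≤ j → Even (conjPart l j))

theorem mem_boundedPartitions {n k : ℕ} {l : Fin n → ℕ} :
    l ∈ boundedPartitions n k ↔ Antitone l ∧ ∀ i, l i ≤ k := by
  simp [boundedPartitions, and_comm]

theorem mem_boundedConjEvenPartitions {n k : ℕ} {l : Fin n → ℕ} :
    l ∈ boundedConjEvenPartitions n k ↔
      (Antitone l ∧ ∀ i, l i ≤ k) ∧ ∀ j : ℕ, 1 ≤ j → Even (conjPart l j) := by
  simp [boundedConjEvenPartitions, mem_boundedPartitions]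

/-- The Hall–Littlewood polynomial
`P_λ(x; q) = ∏_i (1-q)^{m_i} / (q;q)_{m_i} *
  ∑_{w ∈ S_n} w (x_1^{λ_1} ⋯ x_n^{λ_n} ∏_{i<j} (x_i - q x_j) / (x_i - x_j))`.
The normalizing product runs over all the distinct values `i` of the entries of `λ`, the value `0`
included, so that `x_1^{λ_1} ⋯ x_n^{λ_n}` has coefficient `1`. A permutation `w` acts by
`x_i ↦ x_{w i}`. -/
def hallLittlewoodP {K : Type*} [Field K] {n : ℕ} (q : K) (x : Fin n → K) (l : Fin n → ℕ) : K :=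
  (∏ i ∈ Finset.univ.image l, (1 - q) ^ mult l i / qPoch q q (mult l i)) *
    ∑ w : Equiv.Perm (Fin n),
      (∏ i, x (w i) ^ l i) *
        ∏ i, ∏ j ∈ Finset.Ioi i, (x (w i) - q * x (w j)) / (x (w i) - x (w j))

/-- `Φ_q(x; α, β) = ∏_i (1 - α x_i) / (1 - β x_i) * ∏_{i<j} (1 - q x_i x_j) / (1 - x_i x_j)`. -/
def Phi {K : Type*} [Field K] {n : ℕ} (q : K) (x : Fin n → K) (α β : K) : K :=
  (∏ i, (1 - α * x i) / (1 - β * x i)) *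
    ∏ i, ∏ j ∈ Finset.Ioi i, (1 - q * x i * x j) / (1 - x i * x j)

/-- `c_{λ,k}(q) = ∏_{i=1}^{k-1} (q; q²)_{m_i(λ)/2}`, used when all `m_i(λ)`, `i ≥ 1`, are even. -/
def cCoeff {K : Type*} [Field K] {n : ℕ} (q : K) (k : ℕ) (l : Fin n → ℕ) : K :=
  ∏ i ∈ Finset.Ico 1 k, qPoch q (q ^ 2) (mult l i / 2)

/-- `d_{λ,k}(q) = ∏_{i=1}^{k-1} (q; q)_{m_i(λ)} / (q²; q²)_{⌊m_i(λ)/2⌋}`. -/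
def dCoeff {K : Type*} [Field K] {n : ℕ} (q : K) (k : ℕ) (l : Fin n → ℕ) : K :=
  ∏ i ∈ Finset.Ico 1 k, qPoch q q (mult l i) / qPoch (q ^ 2) (q ^ 2) (mult l i / 2)

/-- The field `F(x_1, …, x_n)` of rational functions in `n` indeterminates. -/
abbrev RatField (F : Type*) [Field F] (n : ℕ) : Type _ :=
  FractionRing (MvPolynomial (Fin n) F)

/-- The indeterminate `x_i` as an element of `F(x_1, …, x_n)`. -/
noncomputable def indet (F : Type*) [Field F] (n : ℕ) (i : Fin n) : RatField F n :=
  algebraMap (MvPolynomial (Fin n) F) (RatField F n) (MvPolynomial.X i)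

/-- The scalar `a ∈ F` as an element of `F(x_1, …, x_n)`. -/
noncomputable def scalar {F : Type*} [Field F] (n : ℕ) (a : F) : RatField F n :=
  algebraMap (MvPolynomial (Fin n) F) (RatField F n) (MvPolynomial.C a)

/-- The family `x^ξ = (x_1^{ξ_1}, …, x_n^{ξ_n})` for a sign vector `ξ ∈ {±1}^n`. -/
def signPow {K : Type*} [Field K] {n : ℕ} (x : Fin n → K) (ξ : Fin n → ℤˣ) : Fin n → K :=
  fun i => x i ^ (ξ i : ℤ)

/-- The sign vectors `ξ ∈ {±1}^n` with an even number of entries equal to `-1`. -/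
def evenSigns (n : ℕ) : Finset (Fin n → ℤˣ) :=
  Finset.univ.filter
    (fun ξ => Even (Finset.univ.filter (fun i : Fin n => ξ i = -1)).card)

end HallLittlewood

/-! Functions of finite index sets form an associative algebra under (F * G)(U) = ∑_{S ⊆ U} F(S) G(U
\ S) ∏_{j ∈ S, i ∈ U \ S} (x_j - q x_i)/(x_j - x_i). Multiplication by a multiplicative function,
such as x^S = ∏_{i ∈ S} x_i, is an endomorphism of it (`twist_conv`). Both sides of each identity
are values of products in this algebra at the full index set.

On the right, let S be the set of negative signs of ξ. A pair factor joining j ∈ S to i ∉ S is (1 -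
q x_i/x_j)/(1 - x_i/x_j), which is exactly the weight of the convolution. With φ the set version of
Φ_q(X; s, 1) and φ⁻ the same function of the inverse variables, the sum over all ξ is (x^k φ⁻) * φ
(`sum_signs_eq_conv`). On the left, a sum of P_λ with coefficients depending only on the
multiplicities expands over words with letters 0, …, k (`sum_hallLittlewoodP`), and so does a
product of k + 1 set functions, one for each letter (`iterConv_eq_sum`).

Write 1 for the constant function, which is not the unit, and put T = φ * (-s)^{|·|} and R = 1 *
(-s)^{|·|}; the values of R are Rogers–Szegő polynomials (`conv_const_const`). Interpolation gives
(xφ) * ∏(1 - s x_i) = φ, whence (xT) * 1 = φ and (xT) * R = T. Iterating, φ = (x^k T) * (x^{k-1} R)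
* ⋯ * (x R) * 1. Moreover φ⁻ * T = 1 (`conv_phiSet_inv_phiTail`), because both sides solve the same
triangular linear equation. Therefore (x^k φ⁻) * φ = x^k * (x^{k-1} R) * ⋯ * (x R) * 1. The extreme
levels 0 and k carry the weight 1, which is why the coefficients involve only m_1, …, m_{k-1}.

For s = q the values of R are the factors of d_{λ,k}. For s = 1 they vanish at odd cardinality and
are the factors of c_{λ,k} at even cardinality; T then vanishes on odd sets too, so restricting to
an even number of negative signs restricts m_k to even values. -/

namespace HallLittlewood

open Finset

/-! ### The twisted convolution algebra of set functions. -/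

section Convolution

variable {ι K : Type*} [Field K]

/-- The product of the weights `w j i` over `j ∈ S` and `i ∈ V`. -/
def crossProd (w : ι → ι → K) (S V : Finset ι) : K := ∏ j ∈ S, ∏ i ∈ V, w j i

/-- The multiplicative set function `S ↦ ∏ i ∈ S, p i`. -/
def prodOver (p : ι → K) (S : Finset ι) : K := ∏ i ∈ S, p i

/-- Multiplication of a set function by a multiplicative one. -/
def twist (p : ι → K) (F : Finset ι → K) (S : Finset ι) : K := prodOver p S * F S

theorem twist_prodOver (p r : ι → K) :
    twist p (prodOver r) = prodOver (fun i => p i * r i) := by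
  funext U
  simp only [twist, prodOver, Finset.prod_mul_distrib]

theorem twist_twist (p r : ι → K) (F : Finset ι → K) :
    twist p (twist r F) = twist (fun i => p i * r i) F := by
  funext U
  simp only [twist, prodOver, Finset.prod_mul_distrib, mul_assoc]

theorem twist_one (F : Finset ι → K) : twist (fun _ => 1) F = F := by
  funext U
  simp [twist, prodOver]

variable (w : ι → ι → K)

theorem crossProd_swap (S V : Finset ι) :
    crossProd (fun i j => w j i) S V = crossProd w V S := by
  simp only [crossProd]
  rw [Finset.prod_comm]

variable [DecidableEq ι]

/-- The convolution of set functions twisted by the weights `w`. -/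
def conv (F G : Finset ι → K) (U : Finset ι) : K :=
  ∑ S ∈ U.powerset, F S * G (U \ S) * crossProd w S (U \ S)

theorem crossProd_union_left {S T V : Finset ι} (h : Disjoint S T) :
    crossProd w (S ∪ T) V = crossProd w S V * crossProd w T V := by
  simp only [crossProd, Finset.prod_union h]

theorem crossProd_union_right {S T V : Finset ι} (h : Disjoint T V) :
    crossProd w S (T ∪ V) = crossProd w S T * crossProd w S V := by
  simp only [crossProd, Finset.prod_union h, Finset.prod_mul_distrib]

theorem crossProd_insert_left {a : ι} {S V : Finset ι} (h : a ∉ S) :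
    crossProd w (insert a S) V = (∏ i ∈ V, w a i) * crossProd w S V := by
  simp only [crossProd, Finset.prod_insert h]

theorem crossProd_insert_right {a : ι} {S V : Finset ι} (h : a ∉ V) :
    crossProd w S (insert a V) = (∏ j ∈ S, w j a) * crossProd w S V := by
  simp only [crossProd, Finset.prod_insert h, Finset.prod_mul_distrib]

theorem prodOver_insert {p : ι → K} {a : ι} {S : Finset ι} (h : a ∉ S) :
    prodOver p (insert a S) = p a * prodOver p S := Finset.prod_insert h

theorem prodOver_sdiff {p : ι → K} {S U : Finset ι} (h : S ⊆ U) :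
    prodOver p S * prodOver p (U \ S) = prodOver p U := by
  rw [mul_comm]; exact Finset.prod_sdiff h

theorem conv_empty (F G : Finset ι → K) : conv w F G ∅ = F ∅ * G ∅ := by
  simp [conv, crossProd]

/-- Both sides are sums over ordered splittings of `U` into three blocks, weighted by the cross
products of the three pairs of blocks. -/
theorem conv_assoc (F G H : Finset ι → K) :
    conv w (conv w F G) H = conv w F (conv w G H) := by
  funext U
  simp only [conv, Finset.sum_mul, Finset.mul_sum]
  rw [Finset.sum_sigma', Finset.sum_sigma']
  refine Finset.sum_bij' (fun z _ => ⟨z.2, z.1 \ z.2⟩) (fun z _ => ⟨z.1 ∪ z.2, z.1⟩) ?_ ?_ ?_ ?_ ?_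
  · rintro ⟨S, R⟩ h
    simp only [mem_sigma, mem_powerset] at h ⊢
    exact ⟨h.2.trans h.1, Finset.sdiff_subset_sdiff h.1 le_rfl⟩
  · rintro ⟨R, Q⟩ h
    simp only [mem_sigma, mem_powerset] at h ⊢
    exact ⟨Finset.union_subset h.1 (h.2.trans sdiff_subset), Finset.subset_union_left⟩
  · rintro ⟨S, R⟩ h
    simp only [mem_sigma, mem_powerset] at h
    simp [Finset.union_sdiff_of_subset h.2]
  · rintro ⟨R, Q⟩ h
    simp only [mem_sigma, mem_powerset] at h
    have : Disjoint Q R := (Finset.disjoint_of_subset_left h.2 sdiff_disjoint)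
    simp [Finset.union_sdiff_left, Finset.sdiff_eq_self_of_disjoint this]
  · rintro ⟨S, R⟩ h
    simp only [mem_sigma, mem_powerset] at h
    obtain ⟨hS, hR⟩ := h
    have h1 : (U \ R) \ (S \ R) = U \ S := by
      ext i; simp only [mem_sdiff]
      constructor
      · rintro ⟨⟨a, b⟩, c⟩; exact ⟨a, fun hs => c ⟨hs, b⟩⟩
      · rintro ⟨a, b⟩; exact ⟨⟨a, fun hr => b (hR hr)⟩, fun c => b c.1⟩
    have h2 : U \ R = (S \ R) ∪ (U \ S) := by
      ext i; simp only [mem_sdiff, mem_union]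
      constructor
      · rintro ⟨a, b⟩; by_cases hs : i ∈ S <;> simp [a, b, hs]
      · rintro (⟨a, b⟩ | ⟨a, b⟩)
        · exact ⟨hS a, b⟩
        · exact ⟨a, fun hr => b (hR hr)⟩
    have h3 : Disjoint (S \ R) (U \ S) :=
      Finset.disjoint_of_subset_left sdiff_subset disjoint_sdiff
    have h4 : S = R ∪ (S \ R) := (Finset.union_sdiff_of_subset hR).symm
    have h5 : crossProd w S (U \ S) = crossProd w R (U \ S) * crossProd w (S \ R) (U \ S) := by
      conv_lhs => rw [h4]
      rw [crossProd_union_left w disjoint_sdiff, ← h4]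
    have h6 : crossProd w R (U \ R) = crossProd w R (S \ R) * crossProd w R (U \ S) := by
      rw [h2, crossProd_union_right w h3]
    simp only [h1, h5, h6]
    ring

theorem twist_conv (p : ι → K) (F G : Finset ι → K) :
    twist p (conv w F G) = conv w (twist p F) (twist p G) := by
  funext U
  simp only [conv, twist, Finset.mul_sum]
  refine Finset.sum_congr rfl fun S hS => ?_
  rw [← prodOver_sdiff (mem_powerset.1 hS)]
  ring

/-- Exchange `S` with its complement. The transposed weight arises when all variables are inverted.
-/
theorem conv_swap (F G : Finset ι → K) :
    conv (fun i j => w j i) F G = conv w G F := by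
  funext U
  simp only [conv]
  refine Finset.sum_bij' (fun S _ => U \ S) (fun S _ => U \ S) ?_ ?_ ?_ ?_ ?_
  · intro S _; simp
  · intro S _; simp
  · intro S hS; simpa using mem_powerset.1 hS
  · intro S hS; simpa using mem_powerset.1 hS
  · intro S hS
    rw [Finset.sdiff_sdiff_eq_self (mem_powerset.1 hS), crossProd_swap]
    ring

/-- The convolution on `insert a U`, split according to the factor that receives `a`. -/
theorem conv_insert (F G : Finset ι → K) {a : ι} {U : Finset ι} (ha : a ∉ U) :
    conv w F G (insert a U) =
      ∑ S ∈ U.powerset,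
        (F S * G (insert a (U \ S)) * crossProd w S (U \ S) * (∏ j ∈ S, w j a) +
          F (insert a S) * G (U \ S) * crossProd w S (U \ S) * ∏ i ∈ U \ S, w a i) := by
  rw [conv, Finset.sum_powerset_insert ha, ← Finset.sum_add_distrib]
  refine Finset.sum_congr rfl fun S hS => ?_
  have hS := mem_powerset.1 hS
  have haS : a ∉ S := fun h => ha (hS h)
  rw [Finset.insert_sdiff_of_notMem _ haS, crossProd_insert_right w (by simp [ha]),
    Finset.insert_sdiff_insert, Finset.sdiff_insert_of_notMem ha, crossProd_insert_left w haS]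
  ring

/-- A set function satisfying a linear equation `p·Y * L = R * Y` is determined by its value on the
empty set. -/
theorem eq_of_twist_conv_eq {p : ι → K} (hp : ∀ U : Finset ι, U.Nonempty → prodOver p U ≠ 1)
    {L R Y Z : Finset ι → K} (hL : L ∅ = 1) (hR : R ∅ = 1) (h0 : Y ∅ = Z ∅)
    (hY : conv w (twist p Y) L = conv w R Y) (hZ : conv w (twist p Z) L = conv w R Z) :
    Y = Z := by
  funext U
  induction U using Finset.strongInduction with
  | _ U ih =>
  rcases U.eq_empty_or_nonempty with rfl | hU
  · exact h0
  have eY := congrFun hY U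
  have eZ := congrFun hZ U
  -- Isolate the two terms that contain `Y U`, namely `S = U` on the left and `S = ∅` on the right;
  -- all others involve `Y` on proper subsets only.
  have key : ∀ Y : Finset ι → K, conv w (twist p Y) L U - conv w R Y U =
      (prodOver p U - 1) * Y U + (∑ S ∈ U.powerset.erase U,
        prodOver p S * Y S * L (U \ S) * crossProd w S (U \ S) -
        ∑ S ∈ U.powerset.erase ∅, R S * Y (U \ S) * crossProd w S (U \ S)) := by
    intro Y
    rw [conv, conv, ← Finset.add_sum_erase _ _ (mem_powerset_self U),
      ← Finset.add_sum_erase U.powerset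
        (fun S => R S * Y (U \ S) * crossProd w S (U \ S)) (empty_mem_powerset U)]
    simp only [twist, sdiff_self, hL, hR, sdiff_empty, crossProd, Finset.prod_empty,
      Finset.bot_eq_empty, Finset.prod_const_one]
    ring
  have e1 := key Y
  have e2 := key Z
  have s1 : ∑ S ∈ U.powerset.erase U, prodOver p S * Y S * L (U \ S) * crossProd w S (U \ S) =
      ∑ S ∈ U.powerset.erase U, prodOver p S * Z S * L (U \ S) * crossProd w S (U \ S) := by
    refine Finset.sum_congr rfl fun S hS => ?_
    rw [mem_erase, mem_powerset] at hS
    rw [ih S (Finset.ssubset_iff_subset_ne.2 ⟨hS.2, hS.1⟩)]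
  have s2 : ∑ S ∈ U.powerset.erase ∅, R S * Y (U \ S) * crossProd w S (U \ S) =
      ∑ S ∈ U.powerset.erase ∅, R S * Z (U \ S) * crossProd w S (U \ S) := by
    refine Finset.sum_congr rfl fun S hS => ?_
    rw [mem_erase, mem_powerset] at hS
    rw [ih (U \ S) (Finset.sdiff_ssubset hS.2 (Finset.nonempty_iff_ne_empty.2 hS.1))]
  rw [eY, sub_self, s1, s2] at e1
  rw [eZ, sub_self] at e2
  have h1 : (prodOver p U - 1) * (Y U - Z U) = 0 := by linear_combination e2 - e1
  rcases mul_eq_zero.1 h1 with h | h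
  · exact absurd (sub_eq_zero.1 h) (hp U hU)
  · exact sub_eq_zero.1 h

end Convolution

/-! ### Rogers–Szegő polynomials and convolutions evaluated by interpolation. -/

section Interpolation

open Polynomial

variable {ι K : Type*} [Field K]

/-- The Hall–Littlewood weight `(x_j - q x_i) / (x_j - x_i)`. -/
def hlWeight (q : K) (x : ι → K) (j i : ι) : K := (x j - q * x i) / (x j - x i)

/-- The homogeneous Rogers–Szegő polynomials, defined by a `q`-difference recurrence. -/
def rogersSzego (q : K) : ℕ → K → K → K
  | 0, _, _ => 1
  | n + 1, u, v => v * rogersSzego q n u v + u * rogersSzego q n u (q * v)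

/-- The mirror image of the defining recurrence; agreement of the two yields the symmetry in `u` and
`v`. -/
theorem rogersSzego_succ' (q : K) (n : ℕ) (u v : K) :
    rogersSzego q (n + 1) u v = u * rogersSzego q n u v + v * rogersSzego q n (q * u) v := by
  induction n generalizing u v with
  | zero => simp [rogersSzego]; ring
  | succ n ih =>
    have h : ∀ m u v, rogersSzego q (m + 1) u v =
      v * rogersSzego q m u v + u * rogersSzego q m u (q * v) := fun _ _ _ => rfl
    linear_combination h (n + 1) u v + v * ih u v + u * ih u (q * v) - u * h n u v -
      v * h n (q * u) v

theorem rogersSzego_comm (q : K) (n : ℕ) (u v : K) :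
    rogersSzego q n u v = rogersSzego q n v u := by
  induction n generalizing u v with
  | zero => rfl
  | succ n ih => rw [rogersSzego, rogersSzego_succ', ih u v, ih u (q * v)]

theorem rogersSzego_smul (q c : K) (n : ℕ) (u v : K) :
    rogersSzego q n (c * u) (c * v) = c ^ n * rogersSzego q n u v := by
  induction n generalizing u v with
  | zero => simp [rogersSzego]
  | succ n ih =>
    rw [rogersSzego, ih, show q * (c * v) = c * (q * v) by ring, ih, rogersSzego]
    ring

/-- Eliminating the `q`-shifted argument between the two recurrences leaves a three-term recurrence
at fixed `u` and `v`, suited to the evaluations at `(1, -1)` and `(1, -q)`. -/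
theorem rogersSzego_add_two (q : K) (n : ℕ) (u v : K) :
    rogersSzego q (n + 2) u v =
      (u + v) * rogersSzego q (n + 1) u v - u * v * (1 - q ^ (n + 1)) * rogersSzego q n u v := by
  have h1 : rogersSzego q (n + 2) u v =
    v * rogersSzego q (n + 1) u v + u * rogersSzego q (n + 1) u (q * v) := rfl
  have h2 : rogersSzego q (n + 1) u v =
    v * rogersSzego q n u v + u * rogersSzego q n u (q * v) := rfl
  have h3 := rogersSzego_succ' q n u (q * v)
  rw [rogersSzego_smul] at h3
  linear_combination h1 + u * h3 - u * h2

theorem natDegree_prod_le_card {S : Finset ι} {p : ι → K[X]} (h : ∀ i ∈ S, (p i).natDegree ≤ 1) :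
    (∏ i ∈ S, p i).natDegree ≤ S.card := by
  refine (natDegree_prod_le _ _).trans ?_
  simpa using Finset.sum_le_card_nsmul S (fun i => (p i).natDegree) 1 h

theorem natDegree_linear_sub_le (a b : K) : (C a - C b * X).natDegree ≤ 1 := by
  refine (natDegree_sub_le _ _).trans ?_
  simpa using natDegree_C_mul_le b X

theorem coeff_prod_sub_X (S : Finset ι) (c : ι → K) :
    (∏ i ∈ S, (C (c i) - C 1 * X)).coeff S.card = (-1) ^ S.card := by
  have := coeff_prod_of_natDegree_le S (fun i => C (c i) - C 1 * X) 1
    (fun i _ => natDegree_linear_sub_le _ _)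
  rw [mul_one] at this
  rw [this, Finset.prod_congr rfl (g := fun _ => (-1 : K)), Finset.prod_const]
  intro i _
  simp

section Node

variable {q : K} {x : ι → K}

theorem prod_hlWeight_mul_left (hx : Function.Injective x) {S : Finset ι} {a : ι} (ha : a ∉ S) :
    (∏ j ∈ S, hlWeight q x j a) * ∏ j ∈ S, (x j - x a) = ∏ j ∈ S, (x j - q * x a) := by
  rw [← Finset.prod_mul_distrib]
  refine Finset.prod_congr rfl fun j hj => ?_
  have : x j - x a ≠ 0 := sub_ne_zero.2 fun h => ha (hx h ▸ hj)
  rw [hlWeight, div_mul_cancel₀ _ this]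

theorem prod_hlWeight_mul_right (hx : Function.Injective x) {S : Finset ι} {a : ι} (ha : a ∉ S) :
    (∏ j ∈ S, hlWeight q x a j) * ∏ j ∈ S, (x j - x a) = ∏ j ∈ S, (q * x j - x a) := by
  rw [← Finset.prod_mul_distrib]
  refine Finset.prod_congr rfl fun j hj => ?_
  have : x a - x j ≠ 0 := sub_ne_zero.2 fun h => ha (hx h ▸ hj)
  rw [hlWeight]
  field_simp
  ring

theorem card_image_insert_zero (hx : Function.Injective x) (h0 : ∀ i, x i ≠ 0) [DecidableEq K]
    (U : Finset ι) : (insert 0 (U.image x)).card = U.card + 1 := by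
  rw [Finset.card_insert_of_notMem (by simpa using fun i _ => h0 i),
    Finset.card_image_of_injective _ hx]

variable [DecidableEq ι]

/-- Clearing the denominators in which the variable `x a` occurs. -/
theorem conv_insert_mul_prod (hx : Function.Injective x) (F G : Finset ι → K) {a : ι}
    {U : Finset ι} (ha : a ∉ U) :
    conv (hlWeight q x) F G (insert a U) * ∏ i ∈ U, (x i - x a) =
      ∑ S ∈ U.powerset, crossProd (hlWeight q x) S (U \ S) *
        (F S * G (insert a (U \ S)) *
            ((∏ j ∈ S, (x j - q * x a)) * ∏ i ∈ U \ S, (x i - x a)) +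
          F (insert a S) * G (U \ S) *
            ((∏ i ∈ U \ S, (q * x i - x a)) * ∏ j ∈ S, (x j - x a))) := by
  rw [conv_insert _ _ _ ha, Finset.sum_mul]
  refine Finset.sum_congr rfl fun S hS => ?_
  have hS := mem_powerset.1 hS
  rw [← prod_hlWeight_mul_left hx (fun h => ha (hS h)),
    ← prod_hlWeight_mul_right hx (show a ∉ U \ S by simp [ha]),
    ← Finset.prod_sdiff (f := fun i => x i - x a) hS]
  ring

/-- The symmetry that cancels the residues of a convolution at coinciding variables. -/
theorem sum_eq_zero_at_node (hx : Function.Injective x) {m : ι} {U : Finset ι} (hm : m ∉ U)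
    (F G α β : Finset ι → K)
    (h : ∀ S ⊆ U, F (insert m S) * G (U \ S) * α (insert m S) =
      F S * G (insert m (U \ S)) * β S) :
    ∑ S ∈ (insert m U).powerset, crossProd (hlWeight q x) S (insert m U \ S) *
        (F S * G (insert m U \ S) * α S *
            ((∏ j ∈ S, (x j - q * x m)) * ∏ i ∈ insert m U \ S, (x i - x m)) +
          F S * G (insert m U \ S) * β S *
            ((∏ i ∈ insert m U \ S, (q * x i - x m)) * ∏ j ∈ S, (x j - x m))) = 0 := by
  rw [Finset.sum_powerset_insert hm, ← Finset.sum_add_distrib]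
  refine Finset.sum_eq_zero fun S hS => ?_
  have hS := mem_powerset.1 hS
  have hmS : m ∉ S := fun h => hm (hS h)
  have hmV : m ∉ U \ S := by simp [hm]
  rw [Finset.insert_sdiff_of_notMem _ hmS, crossProd_insert_right _ hmV,
    Finset.insert_sdiff_insert, Finset.sdiff_insert_of_notMem hm, crossProd_insert_left _ hmS]
  simp only [Finset.prod_insert hmS, Finset.prod_insert hmV, sub_self, zero_mul, mul_zero,
    zero_add, add_zero]
  rw [← prod_hlWeight_mul_left hx hmS, ← prod_hlWeight_mul_right hx hmV]
  linear_combination (x m - q * x m) * crossProd (hlWeight q x) S (U \ S) *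
    (∏ j ∈ S, hlWeight q x j m) * (∏ j ∈ S, (x j - x m)) *
    (∏ i ∈ U \ S, hlWeight q x m i) * (∏ i ∈ U \ S, (x i - x m)) * h S hS

/-- Evaluation of the convolution of two geometric set functions. -/
theorem conv_const_const (hx : Function.Injective x) (h0 : ∀ i, x i ≠ 0) (u v : K)
    (U : Finset ι) :
    conv (hlWeight q x) (prodOver fun _ => u) (prodOver fun _ => v) U =
      rogersSzego q U.card u v := by
  classical
  induction U using Finset.induction_on generalizing u v with
  | empty => simp [conv, prodOver, crossProd, rogersSzego]
  | insert a U ha ih =>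
  -- The difference of the two sides, cleared of denominators, with the new variable `x a` replaced
  -- by `X`. Its degree is at most `U.card`, and it vanishes at the `U.card + 1` points 0 and `x m`,
  -- `m ∈ U`.
  set P : K[X] := ∑ S ∈ U.powerset, C (crossProd (hlWeight q x) S (U \ S)) *
      (C (prodOver (fun _ => u) S * prodOver (fun _ => v) (U \ S) * v) *
          ((∏ j ∈ S, (C (x j) - C q * X)) * ∏ i ∈ U \ S, (C (x i) - C 1 * X)) +
        C (prodOver (fun _ => u) S * prodOver (fun _ => v) (U \ S) * u) *
          ((∏ i ∈ U \ S, (C (q * x i) - C 1 * X)) * ∏ j ∈ S, (C (x j) - C 1 * X))) -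
      C (rogersSzego q (U.card + 1) u v) * ∏ i ∈ U, (C (x i) - C 1 * X) with hP
  have hdeg : P.natDegree ≤ U.card := by
    refine (natDegree_sub_le_of_le (natDegree_sum_le_of_forall_le _ _ fun S hS => ?_)
      ((natDegree_C_mul_le _ _).trans (natDegree_prod_le_card fun i _ =>
        natDegree_linear_sub_le _ _))).trans (max_self _).le
    have hS := mem_powerset.1 hS
    have hc : S.card + (U \ S).card = U.card := by
      rw [add_comm, Finset.card_sdiff_add_card_eq_card hS]
    refine (natDegree_C_mul_le _ _).trans ((natDegree_add_le_of_le
      ((natDegree_C_mul_le _ _).trans (natDegree_mul_le_of_le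
        (natDegree_prod_le_card fun i _ => natDegree_linear_sub_le _ _)
        (natDegree_prod_le_card fun i _ => natDegree_linear_sub_le _ _)))
      ((natDegree_C_mul_le _ _).trans (natDegree_mul_le_of_le
        (natDegree_prod_le_card fun i _ => natDegree_linear_sub_le _ _)
        (natDegree_prod_le_card fun i _ => natDegree_linear_sub_le _ _)))).trans ?_)
    rw [hc, add_comm, hc, max_self]
  have hzero : P = 0 := by
    refine eq_zero_of_natDegree_lt_card_of_eval_eq_zero' P (insert 0 (U.image x)) ?_
      (by rw [card_image_insert_zero hx h0]; omega)
    intro z hz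
    rw [mem_insert, mem_image] at hz
    rcases hz with rfl | ⟨m, hm, rfl⟩
    -- At 0 the factors `q * x i` over `U \ S` turn `v` into `q * v`, so the vanishing is the
    -- defining recurrence of `rogersSzego`.
    · simp only [hP, eval_sub, eval_finsetSum, eval_mul, eval_C, eval_add, eval_prod, eval_X,
        mul_zero, sub_zero]
      have e1 := ih u v
      have e2 := ih u (q * v)
      rw [rogersSzego, ← e1, ← e2, conv, conv, Finset.mul_sum, Finset.mul_sum,
        ← Finset.sum_add_distrib, Finset.sum_mul, sub_eq_zero]
      refine Finset.sum_congr rfl fun S hS => ?_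
      have hS := mem_powerset.1 hS
      rw [← Finset.prod_sdiff (f := x) hS, Finset.prod_mul_distrib]
      simp only [prodOver, Finset.prod_const, mul_pow]
      ring
    · obtain ⟨U', hm', rfl⟩ : ∃ U', m ∉ U' ∧ insert m U' = U :=
        ⟨U.erase m, by simp, Finset.insert_erase hm⟩
      have := sum_eq_zero_at_node (q := q) hx hm' (prodOver fun _ => u) (prodOver fun _ => v)
        (fun _ => v) (fun _ => u) (fun S hS => by
          rw [prodOver_insert (fun h => hm' (hS h)), prodOver_insert (by simp [hm'])]; ring)
      simp only [hP, eval_sub, eval_finsetSum, eval_mul, eval_C, eval_add, eval_prod, eval_X,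
        one_mul]
      rw [this, Finset.prod_insert hm']
      simp
  have hev : P.eval (x a) = 0 := by rw [hzero, eval_zero]
  have hne : ∏ i ∈ U, (x i - x a) ≠ 0 :=
    Finset.prod_ne_zero_iff.2 fun i hi => sub_ne_zero.2 fun h => ha (hx h ▸ hi)
  refine mul_right_cancel₀ hne ?_
  rw [conv_insert_mul_prod hx _ _ ha, Finset.card_insert_of_notMem ha]
  simp only [hP, eval_sub, eval_finsetSum, eval_mul, eval_C, eval_add, eval_prod, eval_X,
    one_mul] at hev
  rw [← sub_eq_zero, ← hev]
  congr 1
  refine Finset.sum_congr rfl fun S hS => ?_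
  have hS := mem_powerset.1 hS
  rw [prodOver_insert (fun h => ha (hS h)), prodOver_insert (by simp [ha])]
  ring

/-- The elementary symmetric expansion `∏ (u + y x_i)` as a convolution. -/
theorem conv_linear_const (hx : Function.Injective x) (h0 : ∀ i, x i ≠ 0) (u y : K) :
    conv (hlWeight q x) (prodOver fun i => y * x i) (prodOver fun _ => u) =
      prodOver fun i => u + y * x i := by
  classical
  funext U
  induction U using Finset.induction_on with
  | empty => simp [conv, prodOver, crossProd]
  | insert a U ha ih =>
  set F := prodOver fun i => y * x i with hF
  set G : Finset ι → K := prodOver fun _ => u with hG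
  set P : K[X] := ∑ S ∈ U.powerset, C (crossProd (hlWeight q x) S (U \ S)) *
      (C (F S * G (U \ S) * u) *
          ((∏ j ∈ S, (C (x j) - C q * X)) * ∏ i ∈ U \ S, (C (x i) - C 1 * X)) +
        C (F S * G (U \ S) * y) * (X *
          ((∏ i ∈ U \ S, (C (q * x i) - C 1 * X)) * ∏ j ∈ S, (C (x j) - C 1 * X)))) -
      C (prodOver (fun i => u + y * x i) U) *
        ((C u - C (-y) * X) * ∏ i ∈ U, (C (x i) - C 1 * X)) with hP
  have hcard : ∀ S ∈ U.powerset, S.card + (U \ S).card = U.card := fun S hS => by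
    rw [add_comm, Finset.card_sdiff_add_card_eq_card (mem_powerset.1 hS)]
  have hd1 : ∀ S ∈ U.powerset, ((∏ j ∈ S, (C (x j) - C q * X)) *
      ∏ i ∈ U \ S, (C (x i) - C 1 * X)).natDegree ≤ U.card := fun S hS =>
    (natDegree_mul_le_of_le
        (natDegree_prod_le_card fun i _ => natDegree_linear_sub_le _ _)
        (natDegree_prod_le_card fun i _ => natDegree_linear_sub_le _ _)).trans (hcard S hS).le
  have hd2 : ∀ S ∈ U.powerset, ((∏ i ∈ U \ S, (C (q * x i) - C 1 * X)) *
      ∏ j ∈ S, (C (x j) - C 1 * X)).natDegree ≤ U.card := fun S hS =>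
    (natDegree_mul_le_of_le
        (natDegree_prod_le_card fun i _ => natDegree_linear_sub_le _ _)
        (natDegree_prod_le_card fun i _ => natDegree_linear_sub_le _ _)).trans
      (by rw [add_comm]; exact (hcard S hS).le)
  have hd3 : (∏ i ∈ U, (C (x i) - C 1 * X)).natDegree ≤ U.card :=
    natDegree_prod_le_card fun i _ => natDegree_linear_sub_le _ _
  have hdeg : P.natDegree ≤ U.card + 1 := by
    refine (natDegree_sub_le_of_le (natDegree_sum_le_of_forall_le (n := U.card + 1) _ _
      fun S hS => ?_) ((natDegree_C_mul_le _ _).trans (natDegree_mul_le_of_le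
        (natDegree_linear_sub_le _ _) hd3))).trans (by omega)
    refine (natDegree_C_mul_le _ _).trans ((natDegree_add_le_of_le
      ((natDegree_C_mul_le _ _).trans (hd1 S hS))
      ((natDegree_C_mul_le _ _).trans (natDegree_mul_le_of_le natDegree_X_le
        (hd2 S hS)))).trans (by omega))
  -- The degree bound is `U.card + 1`, one too many for the available nodes; the induction
  -- hypothesis cancels the top coefficient.
  have hcoeff : P.coeff (U.card + 1) = 0 := by
    have c1 : ∀ S ∈ U.powerset, ((∏ j ∈ S, (C (x j) - C q * X)) *
      ∏ i ∈ U \ S, (C (x i) - C 1 * X)).coeff (U.card + 1) = 0 := fun S hS =>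
      coeff_eq_zero_of_natDegree_lt (Nat.lt_succ_of_le (hd1 S hS))
    have c2 : ∀ S ∈ U.powerset, ((∏ i ∈ U \ S, (C (q * x i) - C 1 * X)) *
      ∏ j ∈ S, (C (x j) - C 1 * X)).coeff U.card = (-1) ^ U.card := fun S hS => by
      rw [← hcard S hS, add_comm S.card, coeff_mul_add_eq_of_natDegree_le
        (natDegree_prod_le_card fun i _ => natDegree_linear_sub_le _ _)
        (natDegree_prod_le_card fun i _ => natDegree_linear_sub_le _ _),
        coeff_prod_sub_X, coeff_prod_sub_X, pow_add]
    have c3 : ((C u - C (-y) * X) * ∏ i ∈ U, (C (x i) - C 1 * X)).coeff (U.card + 1) =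
        y * (-1) ^ U.card := by
      rw [add_comm, coeff_mul_add_eq_of_natDegree_le (natDegree_linear_sub_le _ _) hd3,
        coeff_prod_sub_X]
      simp [coeff_C]
    rw [hP, coeff_sub, finsetSum_coeff, coeff_C_mul, c3, ← ih, conv, Finset.sum_mul, sub_eq_zero]
    refine Finset.sum_congr rfl fun S hS => ?_
    rw [coeff_C_mul, coeff_add, coeff_C_mul, coeff_C_mul, coeff_X_mul, c1 S hS, c2 S hS]
    ring
  have hdeg' : P.natDegree < U.card + 1 := by
    refine lt_of_le_of_ne hdeg fun h => ?_
    have h0 : P = 0 := by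
      rw [← leadingCoeff_eq_zero, leadingCoeff, h, hcoeff]
    rw [h0, natDegree_zero] at h
    omega
  have hzero : P = 0 := by
    refine eq_zero_of_natDegree_lt_card_of_eval_eq_zero' P (insert 0 (U.image x)) ?_
      (by rwa [card_image_insert_zero hx h0])
    intro z hz
    rw [mem_insert, mem_image] at hz
    rcases hz with rfl | ⟨m, hm, rfl⟩
    · simp only [hP, eval_sub, eval_finsetSum, eval_mul, eval_C, eval_add, eval_prod, eval_X,
        mul_zero, sub_zero, zero_mul, add_zero]
      rw [← ih, conv, Finset.sum_mul, sub_eq_zero]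
      refine Finset.sum_congr rfl fun S hS => ?_
      rw [← Finset.prod_sdiff (f := x) (mem_powerset.1 hS)]
      ring
    · obtain ⟨U', hm', rfl⟩ : ∃ U', m ∉ U' ∧ insert m U' = U :=
        ⟨U.erase m, by simp, Finset.insert_erase hm⟩
      have := sum_eq_zero_at_node (q := q) hx hm' F G
        (fun _ => u) (fun _ => y * x m) (fun S hS => by
          rw [hF, hG, prodOver_insert (fun h => hm' (hS h)), prodOver_insert (by simp [hm'])]; ring)
      simp only [hP, eval_sub, eval_finsetSum, eval_mul, eval_C, eval_add, eval_prod, eval_X,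
        one_mul]
      rw [Finset.prod_insert hm', sub_self, zero_mul, mul_zero, mul_zero, sub_zero, ← this]
      exact Finset.sum_congr rfl fun S hS => by ring
  have hev : P.eval (x a) = 0 := by rw [hzero, eval_zero]
  have hne : ∏ i ∈ U, (x i - x a) ≠ 0 :=
    Finset.prod_ne_zero_iff.2 fun i hi => sub_ne_zero.2 fun h => ha (hx h ▸ hi)
  refine mul_right_cancel₀ hne ?_
  rw [conv_insert_mul_prod hx _ _ ha, prodOver_insert ha]
  simp only [hP, eval_sub, eval_finsetSum, eval_mul, eval_C, eval_add, eval_prod, eval_X,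
    one_mul, neg_mul, sub_neg_eq_add] at hev
  rw [mul_assoc, mul_left_comm, ← sub_eq_zero, ← hev]
  congr 1
  refine Finset.sum_congr rfl fun S hS => ?_
  have hS := mem_powerset.1 hS
  rw [hF, hG, prodOver_insert (fun h => ha (hS h)), prodOver_insert (by simp [ha])]
  ring

end Node

end Interpolation

/-! ### Products over unordered pairs. -/

section PairProd

variable {ι K : Type*} [Field K] [LinearOrder ι]

/-- The product of `φ i j` over the pairs `i < j` of elements of `U`. -/
def pairProd (φ : ι → ι → K) (U : Finset ι) : K :=
  ∏ i ∈ U, ∏ j ∈ U, if i < j then φ i j else 1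

theorem pairProd_insert {φ : ι → ι → K} (hφ : ∀ i j, φ i j = φ j i) {a : ι} {U : Finset ι}
    (ha : a ∉ U) : pairProd φ (insert a U) = (∏ i ∈ U, φ a i) * pairProd φ U := by
  simp only [pairProd, Finset.prod_insert ha, lt_irrefl, if_false, one_mul,
    Finset.prod_mul_distrib]
  rw [← mul_assoc, ← Finset.prod_mul_distrib]
  congr 1
  refine Finset.prod_congr rfl fun i hi => ?_
  rcases lt_trichotomy a i with h | h | h
  · simp [h, h.not_gt]
  · exact absurd (h ▸ hi) ha
  · simp [h, h.not_gt, hφ a i]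

/-- For symmetric `φ` the order only selects each unordered pair once, so pairs meeting both blocks
contribute a cross product whatever their order. -/
theorem pairProd_union {φ : ι → ι → K} (hφ : ∀ i j, φ i j = φ j i) {S V : Finset ι}
    (h : Disjoint S V) :
    pairProd φ (S ∪ V) = pairProd φ S * pairProd φ V * crossProd φ S V := by
  induction S using Finset.induction_on with
  | empty => simp [pairProd, crossProd]
  | insert a S ha ih =>
    rw [Finset.disjoint_insert_left] at h
    rw [Finset.insert_union, pairProd_insert hφ (by simp [ha, h.1]), ih h.2,
      pairProd_insert hφ ha, crossProd_insert_left _ ha,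
      Finset.prod_union h.2]
    ring

theorem pairProd_congr {φ ψ : ι → ι → K} {U : Finset ι}
    (h : ∀ i ∈ U, ∀ j ∈ U, φ i j = ψ i j) : pairProd φ U = pairProd ψ U :=
  Finset.prod_congr rfl fun i hi => Finset.prod_congr rfl fun j hj => by rw [h i hi j hj]

end PairProd

/-! ### The functional equation of the product ∏ (1 - q x_i x_j)/(1 - x_i x_j). -/

section Core

open Polynomial

variable {ι K : Type*} [Field K] [LinearOrder ι]

/-- The factor `(1 - q x_i x_j) / (1 - x_i x_j)`. -/
def pairFactor (q : K) (x : ι → K) (i j : ι) : K := (1 - q * x i * x j) / (1 - x i * x j)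

variable {q : K} {x : ι → K}

omit [LinearOrder ι] in
theorem pairFactor_comm (i j : ι) : pairFactor q x i j = pairFactor q x j i := by
  rw [pairFactor, pairFactor, mul_right_comm, mul_comm (x i)]

omit [LinearOrder ι] in
theorem prod_pairFactor_mul (h1 : ∀ i j, x i * x j ≠ 1) (a : ι) (S : Finset ι) :
    (∏ j ∈ S, pairFactor q x a j) * ∏ j ∈ S, (1 - x j * x a) =
      ∏ j ∈ S, (1 - q * x j * x a) := by
  rw [← Finset.prod_mul_distrib]
  refine Finset.prod_congr rfl fun j _ => ?_
  have : 1 - x j * x a ≠ 0 := sub_ne_zero.2 (h1 j a).symm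
  rw [pairFactor_comm, pairFactor, div_mul_cancel₀ _ this]

/-- The set function of pair products is reproduced by convolution with `∏ (1 - x_i)`. -/
theorem conv_twist_pairProd (hx : Function.Injective x) (h0 : ∀ i, x i ≠ 0)
    (h1 : ∀ i j, x i * x j ≠ 1) :
    conv (hlWeight q x) (twist x (pairProd (pairFactor q x))) (prodOver fun i => 1 - x i) =
      pairProd (pairFactor q x) := by
  classical
  funext U
  induction U using Finset.strongInduction with
  | _ U ih =>
  rcases U.eq_empty_or_nonempty with rfl | ⟨a, haU⟩
  · simp [conv, twist, prodOver, pairProd, crossProd]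
  obtain ⟨U, ha, rfl⟩ : ∃ V, a ∉ V ∧ insert a V = U :=
    ⟨U.erase a, by simp, Finset.insert_erase haU⟩
  have ihU := ih U (Finset.ssubset_insert ha)
  set E := pairProd (pairFactor q x) with hE
  set F := twist x E with hF
  set G : Finset ι → K := prodOver fun i => 1 - x i with hG
  have hFi : ∀ {b : ι} {S : Finset ι}, b ∉ S →
      F (insert b S) = x b * (∏ j ∈ S, pairFactor q x b j) * F S := fun {b S} hb => by
    rw [hF, hE, twist, twist, prodOver_insert hb, pairProd_insert pairFactor_comm hb]; ring
  have hGi : ∀ {b : ι} {S : Finset ι}, b ∉ S → G (insert b S) = (1 - x b) * G S :=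
    fun {b S} hb => prodOver_insert hb
  -- Here the denominators `1 - x i * x a` are cleared as well, so the degree may reach `2 * U.card
  -- + 1`. The nodes are 0, 1, the `x i` and their inverses, `2 * U.card + 2` in number and distinct
  -- because no `x i * x j` equals 1.
  set P : K[X] := ∑ S ∈ U.powerset, C (crossProd (hlWeight q x) S (U \ S)) *
      (C (F S * G (U \ S)) * ((C 1 - C 1 * X) * ∏ i ∈ U, (C 1 - C (x i) * X)) *
          ((∏ j ∈ S, (C (x j) - C q * X)) * ∏ i ∈ U \ S, (C (x i) - C 1 * X)) +
        C (F S * G (U \ S)) *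
          (X * ((∏ j ∈ S, (C 1 - C (q * x j) * X)) * ∏ i ∈ U \ S, (C 1 - C (x i) * X))) *
          ((∏ i ∈ U \ S, (C (q * x i) - C 1 * X)) * ∏ j ∈ S, (C (x j) - C 1 * X))) -
      C (E U) * ((∏ i ∈ U, (C 1 - C (q * x i) * X)) * ∏ i ∈ U, (C (x i) - C 1 * X)) with hP
  have hdeg : P.natDegree ≤ 2 * U.card + 1 := by
    have hl : ∀ (V : Finset ι) (c d : ι → K),
        (∏ i ∈ V, (C (c i) - C (d i) * X)).natDegree ≤ V.card := fun V c d =>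
      natDegree_prod_le_card fun i _ => natDegree_linear_sub_le _ _
    refine (natDegree_sub_le_of_le (natDegree_sum_le_of_forall_le (n := 2 * U.card + 1) _ _
      fun S hS => ?_) ((natDegree_C_mul_le _ _).trans (natDegree_mul_le_of_le
        (hl _ _ _) (hl _ _ _)))).trans (by omega)
    have hc : S.card + (U \ S).card = U.card := by
      rw [add_comm, Finset.card_sdiff_add_card_eq_card (mem_powerset.1 hS)]
    refine (natDegree_C_mul_le _ _).trans ((natDegree_add_le_of_le
      (natDegree_mul_le_of_le ((natDegree_C_mul_le _ _).trans
        (natDegree_mul_le_of_le (natDegree_linear_sub_le _ _) (hl _ _ _)))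
        (natDegree_mul_le_of_le (hl _ _ _) (hl _ _ _)))
      (natDegree_mul_le_of_le ((natDegree_C_mul_le _ _).trans
        (natDegree_mul_le_of_le natDegree_X_le (natDegree_mul_le_of_le (hl _ _ _) (hl _ _ _))))
        (natDegree_mul_le_of_le (hl _ _ _) (hl _ _ _)))).trans ?_)
    omega
  have hnodes : (insert 0 (insert 1 (U.image x ∪ U.image fun i => (x i)⁻¹))).card =
      2 * U.card + 2 := by
    have hinv : Function.Injective fun i => (x i)⁻¹ := fun i j h => hx (inv_injective h)
    have n1 : ∀ i, x i ≠ 1 := fun i h => h1 i i (by rw [h, one_mul])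
    rw [Finset.card_insert_of_notMem, Finset.card_insert_of_notMem,
      Finset.card_union_of_disjoint, Finset.card_image_of_injective _ hx,
      Finset.card_image_of_injective _ hinv]
    · omega
    · rw [Finset.disjoint_left]
      intro z hz hz'
      obtain ⟨i, -, rfl⟩ := mem_image.1 hz
      obtain ⟨j, -, hj⟩ := mem_image.1 hz'
      exact h1 i j (by rw [← hj, inv_mul_cancel₀ (h0 j)])
    · simp [n1]
    · simp [h0]
  have hzero : P = 0 := by
    refine eq_zero_of_natDegree_lt_card_of_eval_eq_zero' P _ ?_ (by rw [hnodes]; omega)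
    intro z hz
    simp only [hP, eval_sub, eval_finsetSum, eval_mul, eval_C, eval_add, eval_prod, eval_X,
      one_mul]
    rw [mem_insert, mem_insert, mem_union, mem_image, mem_image] at hz
    rcases hz with rfl | rfl | ⟨m, hm, rfl⟩ | ⟨m, hm, rfl⟩
    · simp only [mul_zero, sub_zero, Finset.prod_const_one, one_mul, mul_one, zero_mul, add_zero]
      rw [← ihU, conv, Finset.sum_mul, sub_eq_zero]
      refine Finset.sum_congr rfl fun S hS => ?_
      rw [← Finset.prod_sdiff (f := x) (mem_powerset.1 hS)]
      ring
    -- At 1 the factor `1 - X` kills the terms with `a` outside the first block, and `(1 - x i) * (q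
    -- * x i - 1) = (1 - q * x i) * (x i - 1)` reduces the rest to the identity for `U`.
    · simp only [mul_one, sub_self, zero_mul, mul_zero, zero_add]
      rw [← ihU, conv, Finset.sum_mul, sub_eq_zero]
      refine Finset.sum_congr rfl fun S hS => ?_
      have e : (∏ i ∈ U \ S, (1 - x i)) * ∏ i ∈ U \ S, (q * x i - 1) =
          (∏ i ∈ U \ S, (1 - q * x i)) * ∏ i ∈ U \ S, (x i - 1) := by
        rw [← Finset.prod_mul_distrib, ← Finset.prod_mul_distrib]
        exact Finset.prod_congr rfl fun i _ => by ring
      rw [← Finset.prod_sdiff (f := fun i => 1 - q * x i) (mem_powerset.1 hS),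
        ← Finset.prod_sdiff (f := fun i => x i - 1) (mem_powerset.1 hS)]
      linear_combination crossProd (hlWeight q x) S (U \ S) * F S * G (U \ S) *
        (∏ j ∈ S, (1 - q * x j)) * (∏ j ∈ S, (x j - 1)) * e
    · obtain ⟨U', hm', rfl⟩ : ∃ U', m ∉ U' ∧ insert m U' = U :=
        ⟨U.erase m, by simp, Finset.insert_erase hm⟩
      have := sum_eq_zero_at_node (q := q) hx hm' F G
        (fun _ => (1 - x m) * ∏ i ∈ insert m U', (1 - x i * x m))
        (fun S => x m * ((∏ j ∈ S, (1 - q * x j * x m)) *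
          ∏ i ∈ insert m U' \ S, (1 - x i * x m))) (fun S hS => by
          have hmS : m ∉ S := fun h => hm' (hS h)
          have hmV : m ∉ U' \ S := by simp [hm']
          rw [hFi hmS, hGi hmV, Finset.insert_sdiff_of_notMem _ hmS, Finset.prod_insert hm',
            Finset.prod_insert hmV, ← prod_pairFactor_mul h1,
            ← Finset.prod_sdiff (f := fun i => 1 - x i * x m) hS]
          ring)
      rw [this, Finset.prod_insert hm' (f := fun i => x i - x m)]
      simp
    -- At the inverse of `x m`, only terms with both `a` and `m` in the first block survive, and
    -- they reduce to the identity for `U` without `m`. This removal of two indices is why the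
    -- induction is strong.
    · obtain ⟨U', hm', rfl⟩ : ∃ U', m ∉ U' ∧ insert m U' = U :=
        ⟨U.erase m, by simp, Finset.insert_erase hm⟩
      have ihU' := ih U' ((Finset.ssubset_insert hm').trans (Finset.ssubset_insert ha))
      have hxm := h0 m
      set z := (x m)⁻¹ with hz
      have hmz : x m * z = 1 := mul_inv_cancel₀ hxm
      rw [Finset.prod_insert hm', Finset.sum_powerset_insert hm', ← Finset.sum_add_distrib,
        show E (insert m U') = (∏ i ∈ U', pairFactor q x m i) * E U' from
          pairProd_insert pairFactor_comm hm', ← ihU', conv, Finset.mul_sum, Finset.sum_mul,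
        sub_eq_zero]
      refine Finset.sum_congr rfl fun S hS => ?_
      have hS := mem_powerset.1 hS
      have hmS : m ∉ S := fun h => hm' (hS h)
      have hmV : m ∉ U' \ S := by simp [hm']
      have hV : (∏ i ∈ U' \ S, hlWeight q x m i) * ((∏ i ∈ U' \ S, (1 - x i * z)) *
          ∏ i ∈ U' \ S, (q * x i - z)) = (∏ i ∈ U' \ S, pairFactor q x m i) *
          ((∏ i ∈ U' \ S, (1 - q * x i * z)) * ∏ i ∈ U' \ S, (x i - z)) := by
        simp only [← Finset.prod_mul_distrib]
        refine Finset.prod_congr rfl fun i hi => ?_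
        have a1 : x m - x i ≠ 0 := sub_ne_zero.2 fun h => hmV (hx h ▸ hi)
        have a2 : 1 - x m * x i ≠ 0 := sub_ne_zero.2 (h1 m i).symm
        rw [hlWeight, pairFactor, hz]
        field_simp
        ring
      rw [Finset.insert_sdiff_of_notMem _ hmS, Finset.prod_insert hmV,
        Finset.insert_sdiff_insert, Finset.sdiff_insert_of_notMem hm',
        crossProd_insert_left _ hmS, hFi hmS, Finset.prod_insert hmV (f := fun i => 1 - x i * z),
        Finset.prod_insert hmS (f := fun i => x i - z),
        Finset.prod_insert hmS (f := fun i => 1 - q * x i * z),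
        Finset.prod_insert hm' (f := fun i => 1 - q * x i * z),
        Finset.prod_insert hm' (f := fun i => x i - z),
        ← Finset.prod_sdiff (f := fun i => 1 - q * x i * z) hS,
        ← Finset.prod_sdiff (f := fun i => x i - z) hS,
        ← Finset.prod_sdiff (f := fun i => pairFactor q x m i) hS, hmz]
      clear_value z
      linear_combination crossProd (hlWeight q x) S (U' \ S) * F S * G (U' \ S) *
        (∏ j ∈ S, pairFactor q x m j) * (∏ j ∈ S, (1 - q * x j * z)) *
        (∏ j ∈ S, (x j - z)) * (x m - z) * (1 - q * x m * z) * ((x m * z) * hV + 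
        (∏ i ∈ U' \ S, pairFactor q x m i) *
          ((∏ i ∈ U' \ S, (1 - q * x i * z)) * ∏ i ∈ U' \ S, (x i - z)) * hmz)
  have hev : P.eval (x a) = 0 := by rw [hzero, eval_zero]
  have hne : (∏ i ∈ U, (x i - x a)) * ∏ i ∈ U, (1 - x i * x a) ≠ 0 := mul_ne_zero
    (Finset.prod_ne_zero_iff.2 fun i hi => sub_ne_zero.2 fun h => ha (hx h ▸ hi))
    (Finset.prod_ne_zero_iff.2 fun i _ => sub_ne_zero.2 (h1 i a).symm)
  refine mul_right_cancel₀ hne ?_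
  rw [← mul_assoc, conv_insert_mul_prod hx _ _ ha,
    show E (insert a U) = (∏ i ∈ U, pairFactor q x a i) * E U from
      pairProd_insert pairFactor_comm ha]
  simp only [hP, eval_sub, eval_finsetSum, eval_mul, eval_C, eval_add, eval_prod, eval_X,
    one_mul, ← prod_pairFactor_mul h1 a] at hev
  rw [← sub_eq_zero, Finset.sum_mul, ← hev]
  congr 1
  · refine Finset.sum_congr rfl fun S hS => ?_
    have hS := mem_powerset.1 hS
    rw [hFi (fun h => ha (hS h)), hGi (show a ∉ U \ S by simp [ha]),
      ← Finset.prod_sdiff (f := fun i => 1 - x i * x a) hS]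
    ring
  · ring

end Core

/-! ### The bounded identity inside the convolution algebra. -/

section BoundedIdentity

variable {ι K : Type*} [Field K] [LinearOrder ι] (q s : K) (x : ι → K)

/-- The set function `∏ (1 - s x_i) / (1 - x_i) * ∏_{i<j} (1 - q x_i x_j) / (1 - x_i x_j)`. -/
def phiSet (U : Finset ι) : K :=
  twist (fun i => (1 - s * x i) / (1 - x i)) (pairProd (pairFactor q x)) U

/-- The convolution of `phiSet` with the geometric set function of ratio `-s`. -/
def phiTail : Finset ι → K := conv (hlWeight q x) (phiSet q s x) (prodOver fun _ => -s)

/-- The set function whose values are the Rogers–Szegő polynomials at `-s`. -/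
def rsSet (U : Finset ι) : K := rogersSzego q U.card 1 (-s)

/-- The convolution of the Rogers–Szegő set functions on the levels `k, …, 1` and the constant one
on level `0`. -/
def levelConv : ℕ → Finset ι → K
  | 0 => prodOver fun _ => 1
  | k + 1 => conv (hlWeight q x) (twist (fun i => x i ^ (k + 1)) (rsSet q s)) (levelConv k)

variable {q s x}

theorem rsSet_eq_conv (hx : Function.Injective x) (h0 : ∀ i, x i ≠ 0) :
    conv (hlWeight q x) (prodOver fun _ => 1) (prodOver fun _ => -s) = rsSet q s :=
  funext fun U => conv_const_const hx h0 _ _ U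

/-- The two geometric functions commute because Rogers–Szegő polynomials are symmetric. -/
theorem rsSet_eq_conv' (hx : Function.Injective x) (h0 : ∀ i, x i ≠ 0) :
    conv (hlWeight q x) (prodOver fun _ => -s) (prodOver fun _ => 1) = rsSet q s :=
  funext fun U => (conv_const_const hx h0 _ _ U).trans (rogersSzego_comm _ _ _ _)

/-- This is `conv_twist_pairProd` twisted by (1 - s x_i)/(1 - x_i), whose denominator cancels the
factor 1 - x_i. -/
theorem conv_twist_phiSet (hx : Function.Injective x) (h0 : ∀ i, x i ≠ 0)
    (h1 : ∀ i j, x i * x j ≠ 1) :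
    conv (hlWeight q x) (twist x (phiSet q s x)) (prodOver fun i => 1 - s * x i) =
      phiSet q s x := by
  have hn : ∀ i, 1 - x i ≠ 0 := fun i h => h1 i i (by rw [← sub_eq_zero.1 h, one_mul])
  have h := congrArg (twist fun i => (1 - s * x i) / (1 - x i))
    (conv_twist_pairProd (q := q) hx h0 h1)
  rw [twist_conv, twist_twist, twist_prodOver] at h
  simp only [div_mul_cancel₀ _ (hn _)] at h
  have e : twist x (phiSet q s x) =
      twist (fun i => (1 - s * x i) / (1 - x i) * x i) (pairProd (pairFactor q x)) := by
    change twist x (twist _ _) = _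
    rw [twist_twist]
    simp only [mul_comm]
  rw [e, h]
  rfl

/-- The factor -s x_i from the twisted tail, convolved with the constant 1, assembles into ∏ (1 - s
x_i), to which `conv_twist_phiSet` applies. -/
theorem conv_twist_phiTail_one (hx : Function.Injective x) (h0 : ∀ i, x i ≠ 0)
    (h1 : ∀ i j, x i * x j ≠ 1) :
    conv (hlWeight q x) (twist x (phiTail q s x)) (prodOver fun _ => 1) = phiSet q s x := by
  have h := conv_linear_const (q := q) hx h0 1 (-s)
  rw [phiTail, twist_conv, twist_prodOver, conv_assoc]
  simp only [mul_comm (x _) (-s)]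
  rw [h]
  simp only [neg_mul, ← sub_eq_add_neg]
  exact conv_twist_phiSet hx h0 h1

theorem conv_twist_phiTail (hx : Function.Injective x) (h0 : ∀ i, x i ≠ 0)
    (h1 : ∀ i j, x i * x j ≠ 1) :
    conv (hlWeight q x) (twist x (phiTail q s x)) (rsSet q s) = phiTail q s x := by
  rw [← rsSet_eq_conv hx h0, ← conv_assoc, conv_twist_phiTail_one hx h0 h1]
  rfl

-- Inverting the variables transposes the weight, hence reverses the order of convolution. An
-- identity for `phiSet` at `x` thereby becomes one for the inverse variables in the same algebra.
omit [LinearOrder ι] in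
theorem hlWeight_inv (h0 : ∀ i, x i ≠ 0) :
    hlWeight q (fun i => (x i)⁻¹) = fun i j => hlWeight q x j i := by
  funext j i
  rw [hlWeight, hlWeight]
  have hj := h0 j
  have hi := h0 i
  have e1 : (x j)⁻¹ - q * (x i)⁻¹ = (x i - q * x j) / (x j * x i) := by field_simp
  have e2 : (x j)⁻¹ - (x i)⁻¹ = (x i - x j) / (x j * x i) := by field_simp
  rw [e1, e2, div_div_div_cancel_right₀ (mul_ne_zero hj hi)]

theorem twist_phiSet_inv (hx : Function.Injective x) (h0 : ∀ i, x i ≠ 0)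
    (h1 : ∀ i j, x i * x j ≠ 1) :
    twist x (phiSet q s fun i => (x i)⁻¹) =
      conv (hlWeight q x) (conv (hlWeight q x) (prodOver x) (prodOver fun _ => -s))
        (phiSet q s fun i => (x i)⁻¹) := by
  have h := conv_twist_phiSet (q := q) (s := s) (x := fun i => (x i)⁻¹)
    (fun i j h => hx (inv_injective h)) (fun i => inv_ne_zero (h0 i))
    (fun i j h => h1 i j (by rw [← mul_inv, inv_eq_one] at h; exact h))
  rw [hlWeight_inv h0, conv_swap] at h
  have h2 := congrArg (twist x) h
  rw [twist_conv, twist_twist, twist_prodOver] at h2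
  simp only [mul_inv_cancel₀ (h0 _), twist_one] at h2
  have e : (fun i => x i * (1 - s * (x i)⁻¹)) = fun i => -s + 1 * x i := by
    funext i
    have := h0 i
    field_simp
    ring
  rw [e, ← conv_linear_const hx h0] at h2
  simp only [one_mul] at h2
  exact h2.symm

theorem phiSet_empty : phiSet q s x ∅ = 1 := by simp [phiSet, twist, prodOver, pairProd]

/-- With c = (-s)^{|·|}, both sides solve (xY) * R = (x * c) * Y with value 1 at ∅: the left by the
equations for its two factors, the constant 1 because R = c * 1. Such a solution is unique since x^U
≠ 1 for nonempty U. -/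
theorem conv_phiSet_inv_phiTail (hx : Function.Injective x) (h0 : ∀ i, x i ≠ 0)
    (h1 : ∀ i j, x i * x j ≠ 1) (hp : ∀ U : Finset ι, U.Nonempty → prodOver x U ≠ 1) :
    conv (hlWeight q x) (phiSet q s fun i => (x i)⁻¹) (phiTail q s x) = prodOver fun _ => 1 := by
  refine eq_of_twist_conv_eq (hlWeight q x) (p := x) hp (L := rsSet q s)
    (R := conv (hlWeight q x) (prodOver x) (prodOver fun _ => -s)) ?_ ?_ ?_ ?_ ?_
  · simp [rsSet, rogersSzego]
  · simp [conv_empty, prodOver]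
  · simp [conv_empty, phiTail, prodOver, phiSet_empty]
  · rw [twist_conv, conv_assoc, conv_twist_phiTail hx h0 h1, twist_phiSet_inv hx h0 h1,
      conv_assoc]
  · rw [twist_prodOver, conv_assoc, rsSet_eq_conv' hx h0]
    simp only [mul_one]

/-- Twisting T = (xT) * R by the next power of `x` and substituting it for the leading factor splits
off one more level. -/
theorem phiSet_eq_conv_levelConv (hx : Function.Injective x) (h0 : ∀ i, x i ≠ 0)
    (h1 : ∀ i j, x i * x j ≠ 1) (k : ℕ) :
    conv (hlWeight q x) (twist (fun i => x i ^ (k + 1)) (phiTail q s x)) (levelConv q s x k) =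
      phiSet q s x := by
  induction k with
  | zero =>
    simp only [zero_add, pow_one]
    exact conv_twist_phiTail_one hx h0 h1
  | succ k ih =>
    rw [← ih, levelConv, ← conv_assoc]
    congr 1
    have := congrArg (twist fun i => x i ^ (k + 1)) (conv_twist_phiTail (q := q) (s := s) hx h0 h1)
    rw [twist_conv, twist_twist] at this
    simpa only [← pow_succ] using this

/-- The bounded identity in convolution form. -/
theorem conv_twist_phiSet_eq (hx : Function.Injective x) (h0 : ∀ i, x i ≠ 0)
    (h1 : ∀ i j, x i * x j ≠ 1) (k : ℕ) (B : Finset ι → K) :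
    conv (hlWeight q x) (twist (fun i => x i ^ (k + 1)) B) (phiSet q s x) =
      conv (hlWeight q x) (twist (fun i => x i ^ (k + 1)) (conv (hlWeight q x) B (phiTail q s x)))
        (levelConv q s x k) := by
  conv_lhs => rw [← phiSet_eq_conv_levelConv hx h0 h1 k]
  rw [twist_conv, conv_assoc]

/-- The restriction of a set function to the sets of even cardinality. -/
def evenPart (F : Finset ι → K) (U : Finset ι) : K := if Even U.card then F U else 0

/-- Only splittings with `U \ S` of even size contribute, and for these `S` and `U` have the same
parity. -/
theorem conv_evenPart {w : ι → ι → K} (F : Finset ι → K) {G : Finset ι → K}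
    (hG : ∀ U : Finset ι, ¬ Even U.card → G U = 0) :
    conv w (evenPart F) G = evenPart (conv w F G) := by
  funext U
  have hc : ∀ S ∈ U.powerset, S.card + (U \ S).card = U.card := fun S hS => by
    rw [add_comm, Finset.card_sdiff_add_card_eq_card (mem_powerset.1 hS)]
  simp only [evenPart, conv]
  split_ifs with hU
  · refine Finset.sum_congr rfl fun S hS => ?_
    split_ifs with h
    · rfl
    · have : ¬ Even (U \ S).card := fun h' => by
        rw [← hc S hS, Nat.even_add] at hU; tauto
      rw [hG _ this]; ring
  · refine Finset.sum_eq_zero fun S hS => ?_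
    split_ifs with h
    · have : ¬ Even (U \ S).card := fun h' => by
        rw [← hc S hS, Nat.even_add] at hU; tauto
      rw [hG _ this]; ring
    · ring

/-- In T = (xT) * R at an odd set, every proper splitting has an odd block on one side and vanishes.
What remains is (x^U - 1) T(U) = 0. -/
theorem phiTail_eq_zero (hx : Function.Injective x) (h0 : ∀ i, x i ≠ 0)
    (h1 : ∀ i j, x i * x j ≠ 1) (hp : ∀ U : Finset ι, U.Nonempty → prodOver x U ≠ 1)
    (hs : ∀ U : Finset ι, ¬ Even U.card → rsSet q s U = 0) (U : Finset ι) (hU : ¬ Even U.card) :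
    phiTail q s x U = 0 := by
  induction U using Finset.strongInduction with
  | _ U ih =>
  have hne : U.Nonempty := by
    rw [Finset.nonempty_iff_ne_empty]; rintro rfl; simp at hU
  have h := congrFun (conv_twist_phiTail (q := q) (s := s) hx h0 h1) U
  rw [conv, ← Finset.add_sum_erase _ _ (mem_powerset_self U), Finset.sum_eq_zero, add_zero] at h
  · have e : rsSet q s (U \ U) = 1 := by simp [rsSet, rogersSzego]
    rw [e, sdiff_self] at h
    simp only [twist, crossProd, Finset.bot_eq_empty, Finset.prod_empty,
      Finset.prod_const_one, mul_one] at h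
    have h' : (prodOver x U - 1) * phiTail q s x U = 0 := by linear_combination h
    exact (mul_eq_zero.1 h').resolve_left (sub_ne_zero.2 (hp U hne))
  · intro S hS
    rw [mem_erase, mem_powerset] at hS
    by_cases hSe : Even S.card
    · rw [hs (U \ S), mul_zero, zero_mul]
      intro h'
      rw [← Finset.card_sdiff_add_card_eq_card hS.2, Nat.even_add] at hU
      tauto
    · rw [twist, ih S (Finset.ssubset_iff_subset_ne.2 ⟨hS.2, hS.1⟩) hSe, mul_zero, zero_mul,
        zero_mul]

end BoundedIdentity

/-! ### Iterated convolutions as sums over words. -/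

section Words

variable {ι K : Type*} [Field K] [DecidableEq ι]

/-- The product of the weights `w a b` over the pairs of elements of `U` with `f b < f a`. -/
def descProd (w : ι → ι → K) (f : ι → ℕ) (U : Finset ι) : K :=
  ∏ a ∈ U, ∏ b ∈ U, if f b < f a then w a b else 1

/-- The iterated convolution `F k * ⋯ * F 0`. -/
def iterConv (w : ι → ι → K) (F : ℕ → Finset ι → K) : ℕ → Finset ι → K
  | 0 => F 0
  | k + 1 => conv w (F (k + 1)) (iterConv w F k)

omit [DecidableEq ι] in
theorem descProd_congr (w : ι → ι → K) {f g : ι → ℕ} {U : Finset ι} (h : ∀ i ∈ U, f i = g i) :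
    descProd w f U = descProd w g U :=
  Finset.prod_congr rfl fun a ha => Finset.prod_congr rfl fun b hb => by rw [h a ha, h b hb]

theorem descProd_top (w : ι → ι → K) {f : ι → ℕ} {S V : Finset ι} (hd : Disjoint S V) {t : ℕ}
    (hS : ∀ i ∈ S, f i = t) (hV : ∀ i ∈ V, f i < t) :
    descProd w f (S ∪ V) = crossProd w S V * descProd w f V := by
  simp only [descProd, Finset.prod_union hd, Finset.prod_mul_distrib]
  have e1 : ∏ a ∈ S, ∏ b ∈ S, (if f b < f a then w a b else 1) = 1 :=
    Finset.prod_eq_one fun a ha => Finset.prod_eq_one fun b hb => by simp [hS a ha, hS b hb]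
  have e2 : ∏ a ∈ V, ∏ b ∈ S, (if f b < f a then w a b else 1) = 1 :=
    Finset.prod_eq_one fun a ha => Finset.prod_eq_one fun b hb => by
      rw [if_neg]; rw [hS b hb]; exact (hV a ha).not_gt
  have e3 : ∏ a ∈ S, ∏ b ∈ V, (if f b < f a then w a b else 1) = crossProd w S V :=
    Finset.prod_congr rfl fun a ha => Finset.prod_congr rfl fun b hb => by
      rw [if_pos]; rw [hS a ha]; exact hV b hb
  rw [e1, e2, e3]
  ring

/-- An iterated convolution as a sum over words. -/
theorem iterConv_eq_sum [Fintype ι] (w : ι → ι → K) (F : ℕ → Finset ι → K) (k : ℕ)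
    (U : Finset ι) :
    iterConv w F k U =
      ∑ f ∈ Fintype.piFinset fun i => if i ∈ U then range (k + 1) else {0},
        (∏ v ∈ range (k + 1), F v (U.filter fun i => f i = v)) * descProd w f U := by
  induction k generalizing U with
  | zero =>
    have : (Fintype.piFinset fun i => if i ∈ U then range (0 + 1) else {0}) =
        {fun _ => (0 : ℕ)} := by
      ext f
      simp only [Fintype.mem_piFinset, mem_singleton, funext_iff]
      refine forall_congr' fun i => ?_
      split_ifs <;> simp
    rw [this]
    simp [iterConv, descProd]
  | succ k ih =>
    simp only [iterConv, conv, ih, Finset.mul_sum, Finset.sum_mul]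
    rw [Finset.sum_sigma']
    -- The first block is the set of positions with letter `k + 1`. Words take the default value 0
    -- off their support, so that functions on all of `ι` represent them uniquely.
    refine Finset.sum_bij' (fun z _ i => if i ∈ z.1 then k + 1 else z.2 i)
      (fun f _ => ⟨U.filter fun i => f i = k + 1, fun i => if f i = k + 1 then 0 else f i⟩)
      ?_ ?_ ?_ ?_ ?_
    · rintro ⟨S, g⟩ h
      simp only [mem_sigma, mem_powerset, Fintype.mem_piFinset] at h ⊢
      intro i
      by_cases hi : i ∈ S
      · simp [hi, h.1 hi]
      · have := h.2 i
        by_cases hU : i ∈ U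
        · simp only [mem_sdiff, hU, hi, not_false_eq_true, and_self, if_true, if_false,
            mem_range] at this ⊢
          omega
        · simpa [hU, hi] using this
    · intro f h
      simp only [mem_sigma, mem_powerset, Fintype.mem_piFinset] at h ⊢
      refine ⟨Finset.filter_subset _ _, fun i => ?_⟩
      have := h i
      by_cases hU : i ∈ U
      · by_cases hi : f i = k + 1
        · simp [hU, hi]
        · simp only [hU, hi, if_true, mem_range, mem_sdiff, mem_filter, and_false,
            not_false_eq_true, and_self, if_false] at this ⊢
          omega
      · simp only [hU, if_false, mem_singleton, mem_sdiff, false_and] at this ⊢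
        simp [this]
    · rintro ⟨S, g⟩ h
      simp only [mem_sigma, mem_powerset, Fintype.mem_piFinset] at h
      have hg : ∀ i, g i ≠ k + 1 := fun i => by
        have := h.2 i
        split_ifs at this
        · rw [mem_range] at this; omega
        · rw [mem_singleton] at this; omega
      have hgS : ∀ i ∈ S, g i = 0 := fun i hi => by
        have := h.2 i
        simpa [hi] using this
      have e1 : (U.filter fun i => (if i ∈ S then k + 1 else g i) = k + 1) = S := by
        ext i
        by_cases hi : i ∈ S
        · simp [hi, h.1 hi]
        · simp [hi, hg i]
      simp only [Sigma.mk.injEq, heq_eq_eq]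
      refine ⟨e1, funext fun i => ?_⟩
      by_cases hi : i ∈ S
      · simp [hi, hgS i hi]
      · simp [hi, hg i]
    · intro f h
      funext i
      simp only [Fintype.mem_piFinset] at h
      have := h i
      by_cases hU : i ∈ U
      · by_cases hi : f i = k + 1 <;> simp [hU, hi]
      · simp only [hU, if_false, mem_singleton] at this
        simp [hU, this]
    · rintro ⟨S, g⟩ h
      simp only [mem_sigma, mem_powerset, Fintype.mem_piFinset] at h
      obtain ⟨hS, hg⟩ := h
      have hgV : ∀ i ∈ U \ S, g i < k + 1 := fun i hi => by
        have := hg i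
        rw [if_pos hi, mem_range] at this
        exact this
      set f : ι → ℕ := fun i => if i ∈ S then k + 1 else g i with hf
      have hfS : ∀ i ∈ S, f i = k + 1 := fun i hi => by simp [hf, hi]
      have hfV : ∀ i ∈ U \ S, f i = g i := fun i hi => by simp [hf, (mem_sdiff.1 hi).2]
      have e0 : (U.filter fun i => f i = k + 1) = S := by
        ext i
        rw [mem_filter]
        refine ⟨fun hi => ?_, fun hi => ⟨hS hi, hfS i hi⟩⟩
        by_contra hc
        have hV : i ∈ U \ S := mem_sdiff.2 ⟨hi.1, hc⟩
        have := hgV i hV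
        rw [← hfV i hV, hi.2] at this
        exact lt_irrefl _ this
      have e1 : ∀ v ∈ range (k + 1), (U.filter fun i => f i = v) =
          (U \ S).filter fun i => g i = v := fun v hv => by
        rw [mem_range] at hv
        ext i
        simp only [mem_filter, mem_sdiff]
        by_cases hi : i ∈ S
        · simp [hi, hfS i hi]; omega
        · simp [hf, hi]
      have e2 : descProd w f U = crossProd w S (U \ S) * descProd w g (U \ S) := by
        conv_lhs => rw [← Finset.union_sdiff_of_subset hS]
        rw [descProd_top w disjoint_sdiff hfS fun i hi => (hfV i hi).symm ▸ hgV i hi,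
          descProd_congr w hfV]
      rw [Finset.prod_range_succ (fun v => F v (U.filter fun i => f i = v)), e0, e2,
        Finset.prod_congr (s₁ := range (k + 1)) (f := fun v => F v (U.filter fun i => f i = v)) rfl
          fun v hv => congrArg (F v) (e1 v hv)]
      ring

end Words

/-! ### The Lagrange-type sum behind the `q`-factorials. -/

section Lagrange

open Polynomial

variable {ι K : Type*} [Field K] [DecidableEq ι] {q : K} {x : ι → K}

/-- Interpolation in the variable `x t` again: the apparent poles at the other variables cancel, and
the value at 0 gives the next power of `q`. -/
theorem sum_prod_hlWeight_erase (hx : Function.Injective x) (h0 : ∀ i, x i ≠ 0) (U : Finset ι) :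
    ∑ a ∈ U, ∏ b ∈ U.erase a, hlWeight q x a b = ∑ i ∈ range U.card, q ^ i := by
  classical
  induction U using Finset.induction_on with
  | empty => simp
  | insert t U ht ih =>
  set P : K[X] := ∑ a ∈ U, C (∏ b ∈ U.erase a, hlWeight q x a b) *
      ((C (x a) - C q * X) * ∏ b ∈ U.erase a, (C (x b) - C 1 * X)) +
      ∏ b ∈ U, (C (q * x b) - C 1 * X) -
      C (∑ i ∈ range (U.card + 1), q ^ i) * ∏ b ∈ U, (C (x b) - C 1 * X) with hP
  have hl : ∀ (V : Finset ι) (c : ι → K),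
      (∏ i ∈ V, (C (c i) - C 1 * X)).natDegree ≤ V.card := fun V c =>
    natDegree_prod_le_card fun i _ => natDegree_linear_sub_le _ _
  have hdeg : P.natDegree ≤ U.card := by
    refine (natDegree_sub_le_of_le (natDegree_add_le_of_le (natDegree_sum_le_of_forall_le
      (n := U.card) _ _ fun a ha => ?_) (hl _ _)) ((natDegree_C_mul_le _ _).trans (hl _ _))).trans
      (by omega)
    have hc := Finset.card_erase_add_one ha
    refine (natDegree_C_mul_le _ _).trans ((natDegree_mul_le_of_le (natDegree_linear_sub_le _ _)
      (hl _ _)).trans (by omega))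
  have hzero : P = 0 := by
    refine eq_zero_of_natDegree_lt_card_of_eval_eq_zero' P (insert 0 (U.image x)) ?_
      (by rw [card_image_insert_zero hx h0]; omega)
    intro z hz
    simp only [hP, eval_sub, eval_finsetSum, eval_mul, eval_C, eval_add, eval_prod, eval_X,
      one_mul]
    rw [mem_insert, mem_image] at hz
    rcases hz with rfl | ⟨m, hm, rfl⟩
    · simp only [mul_zero, sub_zero]
      rw [Finset.sum_range_succ, ← ih, Finset.prod_mul_distrib, Finset.prod_const, add_mul,
        Finset.sum_mul, Finset.sum_congr rfl fun a ha => by rw [Finset.mul_prod_erase U x ha]]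
      ring
    · rw [Finset.sum_eq_single_of_mem m hm, ← Finset.mul_prod_erase U _ hm,
        ← Finset.mul_prod_erase U (fun b => x b - x m) hm,
        ← prod_hlWeight_mul_right hx (Finset.notMem_erase m U)]
      · ring
      · intro a _ hne
        rw [Finset.prod_eq_zero (f := fun b => x b - x m) (Finset.mem_erase.2 ⟨hne.symm, hm⟩) (sub_self _)]
        ring
  have hev : P.eval (x t) = 0 := by rw [hzero, eval_zero]
  have hne : ∏ i ∈ U, (x i - x t) ≠ 0 :=
    Finset.prod_ne_zero_iff.2 fun i hi => sub_ne_zero.2 fun h => ht (hx h ▸ hi)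
  refine mul_right_cancel₀ hne ?_
  simp only [hP, eval_sub, eval_finsetSum, eval_mul, eval_C, eval_add, eval_prod, eval_X,
    one_mul] at hev
  rw [Finset.card_insert_of_notMem ht, ← sub_eq_zero, ← hev, Finset.sum_insert ht,
    Finset.erase_insert ht, add_mul, prod_hlWeight_mul_right hx ht, Finset.sum_mul, add_comm]
  congr 2
  refine Finset.sum_congr rfl fun a ha => ?_
  have hta : a ≠ t := fun h => ht (h ▸ ha)
  have hw : hlWeight q x a t * (x a - x t) = x a - q * x t :=
    div_mul_cancel₀ _ (sub_ne_zero.2 fun h => hta (hx h))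
  rw [Finset.erase_insert_of_ne hta.symm, Finset.prod_insert (by simp [ht]),
    ← Finset.mul_prod_erase U _ ha, ← hw]
  ring

end Lagrange

/-! ### Summing over the arrangements that sort a word. -/

section Arrangements

variable {ι K : Type*} [Field K] [DecidableEq ι]

/-- The `q`-factorial `∏_{i=1}^{m} (1 + q + ⋯ + q^{i-1})`. -/
def qFac (q : K) (m : ℕ) : K := ∏ i ∈ range m, ∑ j ∈ range (i + 1), q ^ j

theorem qFac_mul_pow (q : K) (m : ℕ) : qFac q m * (1 - q) ^ m = qPoch q q m := by
  rw [qFac, qPoch, Finset.pow_eq_prod_const, ← Finset.prod_mul_distrib]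
  refine Finset.prod_congr rfl fun i _ => ?_
  have := geom_sum_mul q (i + 1)
  linear_combination -this

/-- The product of the weights of the inversions of a word without repetitions. -/
def wordProd (w : ι → ι → K) {n : ℕ} (r : Fin n → ι) : K :=
  ∏ i, ∏ j, if i < j then w (r i) (r j) else 1

omit [DecidableEq ι] in
theorem wordProd_cons (w : ι → ι → K) {n : ℕ} (a : ι) (r : Fin n → ι) :
    wordProd w (Fin.cons a r : Fin (n + 1) → ι) = (∏ j, w a (r j)) * wordProd w r := by
  simp [wordProd, Fin.prod_univ_succ]

open Classical in
/-- The sum of `wordProd` over the arrangements of `U` along which `f` is weakly decreasing. -/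
noncomputable def arrangementSum (w : ι → ι → K) (f : ι → ℕ) (n : ℕ) (U : Finset ι) [Fintype ι] :
    K :=
  ∑ r : Fin n → ι, if Function.Injective r ∧ univ.image r = U ∧ Antitone (f ∘ r)
    then wordProd w r else 0

/-- Peel off the first entry: it must maximise `f` on `U`, and it precedes all remaining elements.
-/
theorem arrangementSum_succ [Fintype ι] (w : ι → ι → K) (f : ι → ℕ) (n : ℕ) (U : Finset ι) :
    arrangementSum w f (n + 1) U = ∑ a ∈ U.filter fun a => ∀ b ∈ U, f b ≤ f a,
      (∏ b ∈ U.erase a, w a b) * arrangementSum w f n (U.erase a) := by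
  classical
  rw [arrangementSum, ← (Fin.consEquiv fun _ => ι).sum_comp, Fintype.sum_prod_type,
    Finset.sum_filter, ← Finset.sum_filter_add_sum_filter_not univ (· ∈ U)]
  rw [show (univ.filter fun a => a ∈ U) = U by ext; simp]
  rw [Finset.sum_eq_zero (s := univ.filter fun a => a ∉ U), add_zero]
  · refine Finset.sum_congr rfl fun a ha => ?_
    have key : ∀ r : Fin n → ι, (Function.Injective (Fin.cons a r : Fin (n + 1) → ι) ∧
        univ.image (Fin.cons a r : Fin (n + 1) → ι) = U ∧
        Antitone (f ∘ (Fin.cons a r : Fin (n + 1) → ι))) ↔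
        ((∀ b ∈ U, f b ≤ f a) ∧
          (Function.Injective r ∧ univ.image r = U.erase a ∧ Antitone (f ∘ r))) := by
      intro r
      rw [Fin.cons_injective_iff]
      have himg : univ.image (Fin.cons a r : Fin (n + 1) → ι) = insert a (univ.image r) := by
        ext b; simp [Fin.exists_fin_succ, eq_comm]
      rw [himg]
      constructor
      · rintro ⟨⟨har, hr⟩, hU, hanti⟩
        refine ⟨fun b hb => ?_, hr, ?_, fun i j hij => ?_⟩
        · rw [← hU, mem_insert, mem_image] at hb
          rcases hb with rfl | ⟨i, -, rfl⟩
          · exact le_rfl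
          · simpa using hanti (Fin.zero_le i.succ)
        · rw [← hU, Finset.erase_insert (by simpa using har)]
        · simpa using hanti (Fin.succ_le_succ_iff.2 hij)
      · rintro ⟨hmax, hr, hU, hanti⟩
        refine ⟨⟨fun h => ?_, hr⟩, ?_, fun i j hij => ?_⟩
        · have : a ∈ univ.image r := by simpa using h
          rw [hU] at this
          exact absurd rfl (Finset.ne_of_mem_erase this)
        · rw [hU, Finset.insert_erase ha]
        · induction i using Fin.cases with
          | zero =>
            induction j using Fin.cases with
            | zero => exact le_rfl
            | succ j =>
              have : r j ∈ univ.image r := mem_image_of_mem _ (mem_univ _)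
              rw [hU] at this
              simpa using hmax _ (Finset.mem_of_mem_erase this)
          | succ i =>
            induction j using Fin.cases with
            | zero => exact absurd hij (by simp)
            | succ j => simpa using hanti (Fin.succ_le_succ_iff.1 hij)
    have hcons : ∀ r : Fin n → ι, (Fin.consEquiv fun _ => ι) (a, r) =
        (Fin.cons a r : Fin (n + 1) → ι) := fun _ => rfl
    simp only [hcons, key]
    by_cases hmax : ∀ b ∈ U, f b ≤ f a
    · have hT : (∀ b ∈ U, f b ≤ f a) = True := eq_true hmax
      simp only [hT, true_and, if_true]
      rw [arrangementSum, Finset.mul_sum]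
      refine Finset.sum_congr rfl fun r _ => ?_
      split_ifs with h
      · rw [wordProd_cons, ← h.2.1, Finset.prod_image fun i _ j _ hij => h.1 hij]
      · rw [mul_zero]
    · simp [hmax]
  · intro a ha
    refine Finset.sum_eq_zero fun r _ => if_neg ?_
    rintro ⟨-, h, -⟩
    refine (mem_filter.1 ha).2 ?_
    rw [← h]
    exact mem_image.2 ⟨0, mem_univ _, rfl⟩

/-- The arrangements of `U` along which `f` is weakly decreasing sum to a product of
`q`-factorials and of the weights between different levels of `f`. -/
theorem arrangementSum_eq [Fintype ι] {q : K} {x : ι → K} (hx : Function.Injective x)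
    (h0 : ∀ i, x i ≠ 0) (f : ι → ℕ) (T : Finset ℕ) (U : Finset ι) (hT : ∀ i ∈ U, f i ∈ T)
    {n : ℕ} (hn : U.card = n) :
    arrangementSum (hlWeight q x) f n U =
      (∏ v ∈ T, qFac q (U.filter fun i => f i = v).card) * descProd (hlWeight q x) f U := by
  classical
  induction n generalizing U with
  | zero =>
    rw [Finset.card_eq_zero] at hn
    subst hn
    have : ∀ r : Fin 0 → ι, Antitone (f ∘ r) := fun r i => i.elim0
    simp [arrangementSum, wordProd, qFac, descProd, Function.injective_of_subsingleton, this]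
  | succ n ih =>
    rw [arrangementSum_succ]
    obtain ⟨t, ht, hmax⟩ := Finset.exists_max_image U f (Finset.card_pos.1 (by omega))
    set M := U.filter fun i => f i = f t with hM
    have hMeq : (U.filter fun a => ∀ b ∈ U, f b ≤ f a) = M := by
      refine Finset.filter_congr fun a ha => ⟨fun h => le_antisymm (hmax a ha) (h t ht), ?_⟩
      intro h b hb
      rw [h]; exact hmax b hb
    have hMU : M ⊆ U := Finset.filter_subset _ _
    set V := U \ M with hV
    have hMt : ∀ i ∈ M, f i = f t := fun i hi => (mem_filter.1 hi).2
    have hVt : ∀ i ∈ V, f i < f t := fun i hi => by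
      rw [hV, mem_sdiff, hM, mem_filter] at hi
      exact lt_of_le_of_ne (hmax i hi.1) fun h => hi.2 ⟨hi.1, h⟩
    have hUMV : U = M ∪ V := (Finset.union_sdiff_of_subset hMU).symm
    have hdisj : Disjoint M V := disjoint_sdiff
    have hMpos : 0 < M.card := Finset.card_pos.2 ⟨t, mem_filter.2 ⟨ht, rfl⟩⟩
    -- The dependence on the first entry `a` is confined to the weights within the top level `M`.
    -- Summing these over `a` gives the `q`-number of `M.card`, the missing factor of its
    -- `q`-factorial.
    have step : ∀ a ∈ M, (∏ b ∈ U.erase a, hlWeight q x a b) *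
        arrangementSum (hlWeight q x) f n (U.erase a) =
        (∏ b ∈ M.erase a, hlWeight q x a b) * ((qFac q (M.card - 1) *
          ∏ v ∈ T.erase (f t), qFac q (U.filter fun i => f i = v).card) *
          (crossProd (hlWeight q x) M V * descProd (hlWeight q x) f V)) := by
      intro a ha
      have haU := hMU ha
      have haV : a ∉ V := fun h => Finset.disjoint_left.1 hdisj ha h
      have hcard : (U.erase a).card = n := by rw [Finset.card_erase_of_mem haU, hn]; rfl
      have hE : U.erase a = M.erase a ∪ V := by
        rw [hUMV, Finset.erase_union_distrib, Finset.erase_eq_of_notMem haV]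
      have hd : Disjoint (M.erase a) V :=
        Finset.disjoint_of_subset_left (Finset.erase_subset _ _) hdisj
      have h1 := ih (U.erase a) (fun i hi => hT i (Finset.mem_of_mem_erase hi)) hcard
      have hlev : (U.erase a).filter (fun i => f i = f t) = M.erase a := by
        rw [Finset.filter_erase]
      have hlev' : ∀ v ∈ T.erase (f t), (U.erase a).filter (fun i => f i = v) =
          U.filter fun i => f i = v := fun v hv => by
        rw [Finset.filter_erase, Finset.erase_eq_of_notMem]
        rw [mem_filter, hMt a ha]
        exact fun h => Finset.ne_of_mem_erase hv h.2.symm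
      have hdesc : descProd (hlWeight q x) f (U.erase a) =
          crossProd (hlWeight q x) (M.erase a) V * descProd (hlWeight q x) f V := by
        rw [hE, descProd_top _ hd (fun i hi => hMt i (Finset.mem_of_mem_erase hi)) hVt]
      have hcr : crossProd (hlWeight q x) M V =
          (∏ b ∈ V, hlWeight q x a b) * crossProd (hlWeight q x) (M.erase a) V := by
        conv_lhs => rw [← Finset.insert_erase ha]
        rw [crossProd_insert_left _ (Finset.notMem_erase a M)]
      rw [h1, ← Finset.mul_prod_erase T _ (hT t ht), hlev, Finset.card_erase_of_mem ha,
        Finset.prod_congr (s₁ := T.erase (f t)) rfl fun v hv => by rw [hlev' v hv], hdesc, hcr, hE,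
        Finset.prod_union hd]
      ring
    have hdU : descProd (hlWeight q x) f U =
        crossProd (hlWeight q x) M V * descProd (hlWeight q x) f V := by
      conv_lhs => rw [hUMV]
      exact descProd_top _ hdisj hMt hVt
    rw [hMeq, Finset.sum_congr rfl step, ← Finset.sum_mul, sum_prod_hlWeight_erase hx h0,
      ← Finset.mul_prod_erase T _ (hT t ht), ← hM, hdU]
    obtain ⟨m, hm⟩ : ∃ m, M.card = m + 1 := ⟨M.card - 1, by omega⟩
    rw [hm, Nat.add_sub_cancel, qFac, qFac, Finset.prod_range_succ]
    ring

end Arrangements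

/-! ### Hall–Littlewood polynomials as sums over words. -/

section Polynomials

variable {K : Type*} [Field K] {n : ℕ}

theorem sum_perm_eq_arrangementSum (w : Fin n → Fin n → K) (f : Fin n → ℕ) :
    (open Classical in ∑ σ : Equiv.Perm (Fin n), if Antitone (f ∘ σ) then wordProd w σ else 0) =
      arrangementSum w f n univ := by
  classical
  rw [arrangementSum, ← Finset.sum_filter, ← Finset.sum_filter]
  refine Finset.sum_bij (fun σ _ => (σ : Fin n → Fin n)) ?_ ?_ ?_ ?_
  · intro σ hσ
    simp only [mem_filter, mem_univ, true_and] at hσ ⊢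
    exact ⟨σ.injective, by simp, hσ⟩
  · intro σ _ τ _ h
    exact DFunLike.coe_injective h
  · intro r hr
    simp only [mem_filter, mem_univ, true_and] at hr
    exact ⟨Equiv.ofBijective r (Finite.injective_iff_bijective.1 hr.1), by
      simpa using hr.2.2, rfl⟩
  · intro σ _
    rfl

theorem qPoch_self_ne_zero {q : K} {m : ℕ} (hq : ∀ i, 1 ≤ i → i ≤ m → q ^ i ≠ 1) :
    qPoch q q m ≠ 0 := by
  refine Finset.prod_ne_zero_iff.2 fun i hi => ?_
  rw [mem_range] at hi
  rw [← pow_succ', sub_ne_zero]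
  exact (hq (i + 1) (by omega) (by omega)).symm

theorem mult_comp_perm (f : Fin n → ℕ) (σ : Equiv.Perm (Fin n)) (v : ℕ) :
    mult (f ∘ σ) v = mult f v := by
  rw [mult, mult]
  exact Finset.card_bij (fun i _ => σ i) (by simp) (fun i _ j _ h => σ.injective h)
    (fun j hj => ⟨σ.symm j, by simpa using hj, by simp⟩)

/-- A sum of Hall–Littlewood polynomials as a sum over words. -/
theorem sum_hallLittlewoodP {q : K} (hq : ∀ m, 1 ≤ m → m ≤ n → q ^ m ≠ 1) {x : Fin n → K}
    (hx : Function.Injective x) (h0 : ∀ i, x i ≠ 0) (k : ℕ) (c : (Fin n → ℕ) → K)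
    (hc : ∀ f (σ : Equiv.Perm (Fin n)), c (f ∘ σ) = c f) :
    ∑ l ∈ boundedPartitions n k, c l * hallLittlewoodP q x l =
      ∑ f ∈ Fintype.piFinset fun _ : Fin n => range (k + 1),
        c f * (∏ i, x i ^ f i) * descProd (hlWeight q x) f univ := by
  classical
  set N : (Fin n → ℕ) → K := fun l =>
    ∏ i ∈ univ.image l, (1 - q) ^ mult l i / qPoch q q (mult l i) with hN
  have hNσ : ∀ f (σ : Equiv.Perm (Fin n)), N (f ∘ σ) = N f := fun f σ => by
    simp only [hN, mult_comp_perm]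
    rw [← Finset.image_image, Finset.image_univ_equiv]
  -- The normalisation of P_λ is the inverse of the `q`-factorials produced by `arrangementSum_eq`;
  -- multiplicities are at most `n`, so `hq` excludes zero denominators.
  have hNq : ∀ f : Fin n → ℕ, N f * ∏ v ∈ univ.image f, qFac q (mult f v) = 1 := fun f => by
    rw [hN, ← Finset.prod_mul_distrib]
    refine Finset.prod_eq_one fun v _ => ?_
    have hne : qPoch q q (mult f v) ≠ 0 := qPoch_self_ne_zero fun i h1 h2 =>
      hq i h1 (h2.trans ((Finset.card_filter_le _ _).trans (by simp)))
    rw [div_mul_eq_mul_div, mul_comm, qFac_mul_pow, div_self hne]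
  have hP : ∀ l, hallLittlewoodP q x l = N l * ∑ σ : Equiv.Perm (Fin n),
      (∏ i, x (σ i) ^ l i) * wordProd (hlWeight q x) σ := fun l => by
    rw [hallLittlewoodP]
    congr 1
    refine Finset.sum_congr rfl fun σ _ => ?_
    congr 1
    refine Finset.prod_congr rfl fun i _ => ?_
    rw [← Finset.prod_filter]
    refine Finset.prod_congr ?_ fun _ _ => rfl
    ext j
    simp
  calc ∑ l ∈ boundedPartitions n k, c l * hallLittlewoodP q x l
      = ∑ σ : Equiv.Perm (Fin n), ∑ l ∈ Fintype.piFinset fun _ : Fin n => range (k + 1),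
          if Antitone l then c l * N l * (∏ i, x (σ i) ^ l i) * wordProd (hlWeight q x) σ
          else 0 := by
        rw [Finset.sum_comm, boundedPartitions, Finset.sum_filter]
        refine Finset.sum_congr rfl fun l _ => ?_
        split_ifs with h
        · rw [hP, ← mul_assoc, Finset.mul_sum]
          exact Finset.sum_congr rfl fun σ _ => by ring
        · simp
    _ = ∑ σ : Equiv.Perm (Fin n), ∑ f ∈ Fintype.piFinset fun _ : Fin n => range (k + 1),
          if Antitone (f ∘ σ) then c f * N f * (∏ i, x i ^ f i) * wordProd (hlWeight q x) σ
          else 0 := by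
        refine Finset.sum_congr rfl fun σ _ => ?_
        -- Moving `σ` from the variables to the exponents makes the monomial independent of `σ`; the
        -- partition condition becomes that `σ` sorts the word.
        refine Finset.sum_bij' (fun l _ => l ∘ σ.symm) (fun f _ => f ∘ σ) ?_ ?_ ?_ ?_ ?_
        · intro l hl
          rw [Fintype.mem_piFinset] at hl ⊢
          exact fun i => hl _
        · intro f hf
          rw [Fintype.mem_piFinset] at hf ⊢
          exact fun i => hf _
        · intro l _
          funext i
          simp
        · intro f _
          funext i
          simp
        · intro l _
          rw [hc, hNσ, ← Equiv.prod_comp σ fun i => x i ^ (l ∘ σ.symm) i]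
          simp [Function.comp_assoc]
    _ = _ := by
        rw [Finset.sum_comm]
        refine Finset.sum_congr rfl fun f _ => ?_
        have h1 := arrangementSum_eq (q := q) hx h0 f (univ.image f) univ
          (fun i _ => mem_image_of_mem _ (mem_univ i)) (Finset.card_fin n)
        rw [← sum_perm_eq_arrangementSum] at h1
        have h2 : ∀ σ : Equiv.Perm (Fin n),
            (if Antitone (f ∘ σ) then c f * N f * (∏ i, x i ^ f i) * wordProd (hlWeight q x) σ
              else 0) = c f * N f * (∏ i, x i ^ f i) *
              (if Antitone (f ∘ σ) then wordProd (hlWeight q x) σ else 0) := fun σ => by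
          split_ifs <;> simp
        rw [Finset.sum_congr rfl fun σ _ => h2 σ, ← Finset.mul_sum, h1]
        have h3 := hNq f
        simp only [mult] at h3
        linear_combination c f * (∏ i, x i ^ f i) * descProd (hlWeight q x) f univ * h3

end Polynomials

/-! ### Rogers–Szegő polynomials at `(1, -1)` and `(1, -q)`. -/

section Coefficients

variable {K : Type*} [Field K] (q : K)

theorem qPoch_succ (a p : K) (m : ℕ) : qPoch a p (m + 1) = qPoch a p m * (1 - a * p ^ m) :=
  Finset.prod_range_succ _ _

/-- At u + v = 0 the middle term of the three-term recurrence disappears, so the two parities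
decouple. -/
theorem rogersSzego_neg_one (m : ℕ) :
    rogersSzego q (2 * m) 1 (-1) = qPoch q (q ^ 2) m ∧ rogersSzego q (2 * m + 1) 1 (-1) = 0 := by
  induction m with
  | zero => simp [rogersSzego, qPoch]
  | succ m ih =>
    have h1 := rogersSzego_add_two q (2 * m) 1 (-1)
    have h2 := rogersSzego_add_two q (2 * m + 1) 1 (-1)
    rw [ih.1, ih.2] at h1
    rw [ih.2] at h2
    refine ⟨?_, ?_⟩
    · rw [show 2 * (m + 1) = 2 * m + 2 by ring, h1, qPoch_succ, ← pow_mul]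
      ring
    · rw [show 2 * (m + 1) + 1 = 2 * m + 1 + 2 by ring, h2]
      ring

theorem rogersSzego_neg_one_of_even {m : ℕ} (hm : Even m) :
    rogersSzego q m 1 (-1) = qPoch q (q ^ 2) (m / 2) := by
  obtain ⟨r, rfl⟩ := hm
  rw [← two_mul, (rogersSzego_neg_one q r).1, Nat.mul_div_cancel_left _ two_pos]

theorem rogersSzego_neg_one_of_not_even {m : ℕ} (hm : ¬ Even m) :
    rogersSzego q m 1 (-1) = 0 := by
  obtain ⟨r, rfl⟩ := Nat.not_even_iff_odd.1 hm
  exact (rogersSzego_neg_one q r).2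

theorem rogersSzego_neg_self (m : ℕ) :
    rogersSzego q (2 * m) 1 (-q) = qPoch q (q ^ 2) m ∧
      rogersSzego q (2 * m + 1) 1 (-q) = qPoch q (q ^ 2) (m + 1) := by
  induction m with
  | zero => simp [rogersSzego, qPoch]; ring
  | succ m ih =>
    have h1 := rogersSzego_add_two q (2 * m) 1 (-q)
    have h2 := rogersSzego_add_two q (2 * m + 1) 1 (-q)
    rw [ih.1, ih.2] at h1
    rw [ih.2] at h2
    have h3 : rogersSzego q (2 * m + 2) 1 (-q) = qPoch q (q ^ 2) (m + 1) := by
      rw [h1, qPoch_succ, ← pow_mul]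
      ring
    refine ⟨h3, ?_⟩
    rw [show 2 * (m + 1) + 1 = 2 * m + 1 + 2 by ring, h2, h3, qPoch_succ _ _ (m + 1), ← pow_mul]
    ring

/-- Separate the odd and even powers of `q`; this converts the values at `(1, -q)` into the
quotients in d_{λ,k}. -/
theorem qPoch_self_eq (m : ℕ) :
    qPoch q q (2 * m) = qPoch q (q ^ 2) m * qPoch (q ^ 2) (q ^ 2) m ∧
      qPoch q q (2 * m + 1) = qPoch q (q ^ 2) (m + 1) * qPoch (q ^ 2) (q ^ 2) m := by
  have hodd : ∀ m, qPoch q q (2 * m) = qPoch q (q ^ 2) m * qPoch (q ^ 2) (q ^ 2) m →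
      qPoch q q (2 * m + 1) = qPoch q (q ^ 2) (m + 1) * qPoch (q ^ 2) (q ^ 2) m := fun m h => by
    rw [qPoch_succ, h, qPoch_succ q, ← pow_mul]
    ring
  have heven : qPoch q q (2 * m) = qPoch q (q ^ 2) m * qPoch (q ^ 2) (q ^ 2) m := by
    induction m with
    | zero => simp [qPoch]
    | succ m ih =>
      rw [show 2 * (m + 1) = 2 * m + 1 + 1 by ring, qPoch_succ, hodd m ih,
        qPoch_succ (q ^ 2), ← pow_mul]
      ring
  exact ⟨heven, hodd m heven⟩

theorem rogersSzego_neg_self_eq_div {m : ℕ} (hq : ∀ i, 1 ≤ i → i ≤ m → q ^ i ≠ 1) :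
    rogersSzego q m 1 (-q) = qPoch q q m / qPoch (q ^ 2) (q ^ 2) (m / 2) := by
  have hne : qPoch (q ^ 2) (q ^ 2) (m / 2) ≠ 0 := by
    refine Finset.prod_ne_zero_iff.2 fun i hi => ?_
    rw [mem_range] at hi
    rw [← pow_succ', ← pow_mul, sub_ne_zero]
    exact (hq _ (by omega) (by omega)).symm
  rw [eq_div_iff hne]
  rcases Nat.even_or_odd' m with ⟨r, rfl | rfl⟩
  · rw [Nat.mul_div_cancel_left _ two_pos, (rogersSzego_neg_self q r).1, (qPoch_self_eq q r).1]
  · rw [show (2 * r + 1) / 2 = r by omega, (rogersSzego_neg_self q r).2, (qPoch_self_eq q r).2]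

end Coefficients

/-! ### The sum over sign vectors as a convolution. -/

section Signs

variable {K : Type*} [Field K] {n : ℕ} {q s : K} {x : Fin n → K}

theorem pairProd_univ (φ : Fin n → Fin n → K) :
    pairProd φ univ = ∏ i, ∏ j ∈ Ioi i, φ i j := by
  refine Finset.prod_congr rfl fun i _ => ?_
  rw [← Finset.prod_filter]
  refine Finset.prod_congr ?_ fun _ _ => rfl
  ext j
  simp

theorem signPow_of_neg {ξ : Fin n → ℤˣ} {i : Fin n} (h : ξ i = -1) :
    signPow x ξ i = (x i)⁻¹ := by simp [signPow, h]

theorem signPow_of_ne {ξ : Fin n → ℤˣ} {i : Fin n} (h : ξ i ≠ -1) : signPow x ξ i = x i := by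
  have h1 : ξ i = 1 := (Int.units_eq_one_or (ξ i)).resolve_right h
  simp [signPow, h1]

/-- A summand of the right-hand side in terms of the set of negative signs. -/
theorem Phi_signPow_mul (h0 : ∀ i, x i ≠ 0) {α β : K}
    (hαβ : ∀ i, (1 - α * x i) / (1 - β * x i) = (1 - s * x i) / (1 - x i) ∧
      (1 - α * (x i)⁻¹) / (1 - β * (x i)⁻¹) = (1 - s * (x i)⁻¹) / (1 - (x i)⁻¹))
    (k : ℕ) (ξ : Fin n → ℤˣ) {S : Finset (Fin n)} (hS : univ.filter (fun i => ξ i = -1) = S) :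
    Phi q (signPow x ξ) α β * ∏ i, x i ^ ((k : ℤ) * (1 - (ξ i : ℤ)) / 2) =
      twist (fun i => x i ^ k) (phiSet q s fun i => (x i)⁻¹) S * phiSet q s x (univ \ S) *
        crossProd (hlWeight q x) S (univ \ S) := by
  have hmem : ∀ {i}, i ∈ S ↔ ξ i = -1 := fun {i} => by rw [← hS]; simp
  have hy : ∀ i ∈ S, signPow x ξ i = (x i)⁻¹ := fun i hi => signPow_of_neg (hmem.1 hi)
  have hy' : ∀ i ∈ univ \ S, signPow x ξ i = x i := fun i hi =>
    signPow_of_ne fun h => (mem_sdiff.1 hi).2 (hmem.2 h)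
  have hsplit : ∀ g : Fin n → K, ∏ i, g i = (∏ i ∈ S, g i) * ∏ i ∈ univ \ S, g i := fun g => by
    rw [mul_comm, Finset.prod_sdiff (Finset.subset_univ S)]
  have e1 : ∏ i, (1 - α * signPow x ξ i) / (1 - β * signPow x ξ i) =
      (∏ i ∈ S, (1 - s * (x i)⁻¹) / (1 - (x i)⁻¹)) *
        ∏ i ∈ univ \ S, (1 - s * x i) / (1 - x i) := by
    rw [hsplit]
    congr 1
    · exact Finset.prod_congr rfl fun i hi => by rw [hy i hi, (hαβ i).2]
    · exact Finset.prod_congr rfl fun i hi => by rw [hy' i hi, (hαβ i).1]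
  have e2 : ∏ i, x i ^ ((k : ℤ) * (1 - (ξ i : ℤ)) / 2) = ∏ i ∈ S, x i ^ k := by
    rw [hsplit, Finset.prod_eq_one (s := univ \ S), mul_one]
    · refine Finset.prod_congr rfl fun i hi => ?_
      rw [hmem.1 hi, show (k : ℤ) * (1 - ((-1 : ℤˣ) : ℤ)) / 2 = k by
        rw [show (1 - ((-1 : ℤˣ) : ℤ)) = 2 by rfl]; omega, zpow_natCast]
    · intro i hi
      have : ξ i = 1 := (Int.units_eq_one_or (ξ i)).resolve_right fun h =>
        (mem_sdiff.1 hi).2 (hmem.2 h)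
      simp [this]
  have e3 : ∏ i, ∏ j ∈ Ioi i, (1 - q * signPow x ξ i * signPow x ξ j) /
      (1 - signPow x ξ i * signPow x ξ j) =
      pairProd (pairFactor q fun i => (x i)⁻¹) S * pairProd (pairFactor q x) (univ \ S) *
        crossProd (hlWeight q x) S (univ \ S) := by
    have h := pairProd_union (φ := pairFactor q (signPow x ξ)) pairFactor_comm
      (disjoint_sdiff : Disjoint S (univ \ S))
    rw [Finset.union_sdiff_of_subset (Finset.subset_univ S), pairProd_univ] at h
    refine h.trans ?_
    congr 1
    · congr 1
      · exact pairProd_congr fun i hi j hj => by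
          rw [pairFactor, pairFactor, hy i hi, hy j hj]
      · exact pairProd_congr fun i hi j hj => by
          rw [pairFactor, pairFactor, hy' i hi, hy' j hj]
    · refine Finset.prod_congr rfl fun j hj => Finset.prod_congr rfl fun i hi => ?_
      rw [pairFactor, hlWeight, hy j hj, hy' i hi]
      have hj0 := h0 j
      rw [← mul_div_mul_left _ _ hj0]
      congr 1 <;> field_simp
  rw [Phi, e1, e2, e3]
  simp only [phiSet, twist, prodOver]
  ring

theorem sum_signs_eq_conv (h0 : ∀ i, x i ≠ 0) {α β : K}
    (hαβ : ∀ i, (1 - α * x i) / (1 - β * x i) = (1 - s * x i) / (1 - x i) ∧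
      (1 - α * (x i)⁻¹) / (1 - β * (x i)⁻¹) = (1 - s * (x i)⁻¹) / (1 - (x i)⁻¹))
    (k : ℕ) (p : ℕ → Prop) [DecidablePred p] :
    ∑ ξ ∈ univ.filter (fun ξ : Fin n → ℤˣ => p (univ.filter fun i => ξ i = -1).card),
        Phi q (signPow x ξ) α β * ∏ i, x i ^ ((k : ℤ) * (1 - (ξ i : ℤ)) / 2) =
      conv (hlWeight q x) (twist (fun i => x i ^ k) fun S =>
        if p S.card then phiSet q s (fun i => (x i)⁻¹) S else 0) (phiSet q s x) univ := by
  have hne : (1 : ℤˣ) ≠ -1 := by decide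
  rw [conv, Finset.sum_filter]
  refine Finset.sum_bij' (fun ξ _ => univ.filter fun i => ξ i = -1)
    (fun S _ i => if i ∈ S then -1 else 1) ?_ ?_ ?_ ?_ ?_
  · simp
  · simp
  · intro ξ _
    funext i
    rcases Int.units_eq_one_or (ξ i) with h | h
    · simp [h, hne]
    · simp [h]
  · intro S _
    ext i
    by_cases hi : i ∈ S <;> simp [hi, hne]
  · intro ξ _
    simp only [twist]
    split_ifs with h
    · exact Phi_signPow_mul h0 hαβ k ξ rfl
    · ring

end Signs

/-! ### The two identities for generic points of a field. -/

section Main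

variable {K : Type*} [Field K] {n : ℕ} {q s : K} {x : Fin n → K}

theorem conv_levelConv_eq_sum (k : ℕ) (B : Finset (Fin n) → K) :
    conv (hlWeight q x) (twist (fun i => x i ^ (k + 1)) B) (levelConv q s x k) univ =
      ∑ f ∈ Fintype.piFinset fun _ : Fin n => range (k + 1 + 1),
        (B (univ.filter fun i => f i = k + 1) *
          ∏ v ∈ Ico 1 (k + 1), rsSet q s (univ.filter fun i => f i = v)) *
          (∏ i, x i ^ f i) * descProd (hlWeight q x) f univ := by
  -- Level weights without the powers of `x`: the constant 1 at the bottom, `B` at the top, `rsSet`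
  -- in between.
  set c : ℕ → Finset (Fin n) → K := fun v =>
    if v = 0 then fun _ => 1 else if v = k + 1 then B else rsSet q s with hc
  set G : ℕ → Finset (Fin n) → K := fun v => twist (fun i => x i ^ v) (c v) with hG
  have hlevel : ∀ r ≤ k, iterConv (hlWeight q x) G r = levelConv q s x r := by
    intro r hr
    induction r with
    | zero =>
      funext U
      simp [iterConv, levelConv, hG, hc, twist, prodOver]
    | succ r ih =>
      have : c (r + 1) = rsSet q s := by
        simp only [hc]
        rw [if_neg (by omega), if_neg (by omega)]
      rw [iterConv, levelConv, ih (by omega), hG]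
      simp only [this]
  have hG1 : G (k + 1) = twist (fun i => x i ^ (k + 1)) B := by simp [hG, hc]
  rw [← hlevel k le_rfl, ← hG1]
  change iterConv (hlWeight q x) G (k + 1) univ = _
  rw [iterConv_eq_sum]
  simp only [mem_univ, if_true]
  refine Finset.sum_congr rfl fun f hf => ?_
  congr 1
  rw [Fintype.mem_piFinset] at hf
  simp only [hG, twist, Finset.prod_mul_distrib]
  have e1 : ∏ v ∈ range (k + 1 + 1), prodOver (fun i => x i ^ v) (univ.filter fun i => f i = v) =
      ∏ i, x i ^ f i := by
    rw [← Finset.prod_fiberwise_of_maps_to (s := univ) (t := range (k + 1 + 1)) (g := f)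
      (fun i _ => hf i)]
    refine Finset.prod_congr rfl fun v _ => Finset.prod_congr rfl fun i hi => ?_
    rw [(mem_filter.1 hi).2]
  have e2 : ∏ v ∈ range (k + 1 + 1), c v (univ.filter fun i => f i = v) =
      B (univ.filter fun i => f i = k + 1) *
        ∏ v ∈ Ico 1 (k + 1), rsSet q s (univ.filter fun i => f i = v) := by
    rw [Finset.prod_range_succ, Finset.range_eq_Ico,
      Finset.prod_eq_prod_Ico_succ_bot (Nat.succ_pos k), mul_comm]
    congr 1
    · simp [hc]
    · rw [show c 0 = fun _ => 1 by simp [hc], one_mul]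
      refine Finset.prod_congr rfl fun v hv => ?_
      rw [mem_Ico] at hv
      simp only [hc]
      rw [if_neg (by omega), if_neg (by omega)]
  rw [e1, e2]
  ring

/-- Multiplicities are successive differences of conjugate parts, which vanish beyond `k`; evenness
therefore propagates downwards from there. -/
theorem even_conjPart_iff {l : Fin n → ℕ} {k : ℕ} (hl : ∀ i, l i ≤ k) :
    (∀ j, 1 ≤ j → Even (conjPart l j)) ↔ ∀ v ∈ Ico 1 (k + 1), Even (mult l v) := by
  have hrec : ∀ j, conjPart l j = mult l j + conjPart l (j + 1) := fun j => by
    rw [conjPart, mult, conjPart, ← Finset.card_union_of_disjoint]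
    · congr 1
      ext i
      simp only [mem_filter, mem_univ, true_and, mem_union]
      omega
    · rw [Finset.disjoint_filter]
      intro i _ h
      omega
  constructor
  · intro h v hv
    have h1 := h v (mem_Ico.1 hv).1
    rw [hrec, Nat.even_add] at h1
    exact h1.2 (h (v + 1) (by omega))
  · intro h
    have hbig : ∀ j, k < j → conjPart l j = 0 := fun j hj => by
      rw [conjPart, Finset.card_eq_zero, Finset.filter_eq_empty_iff]
      intro i _ hi
      have := hl i
      omega
    have hdown : ∀ d j, 1 ≤ j → k + 1 ≤ j + d → Even (conjPart l j) := by
      intro d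
      induction d with
      | zero => intro j _ hj; rw [hbig j (by omega)]; exact Even.zero
      | succ d ih =>
        intro j hj hd
        by_cases hk : k < j
        · rw [hbig j hk]; exact Even.zero
        · rw [hrec]
          exact (h j (mem_Ico.2 ⟨hj, by omega⟩)).add (ih (j + 1) (by omega) (by omega))
    exact fun j hj => hdown (k + 1) j hj (by omega)

section Generic

variable (hq : ∀ m : ℕ, 1 ≤ m → m ≤ n → q ^ m ≠ 1) (hx : Function.Injective x)
  (h0 : ∀ i, x i ≠ 0) (h1 : ∀ i j, x i * x j ≠ 1)
  (hp : ∀ U : Finset (Fin n), U.Nonempty → prodOver x U ≠ 1)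

include hq hx h0 h1 hp

theorem sum_dCoeff_hallLittlewoodP (k : ℕ) :
    ∑ l ∈ boundedPartitions n (k + 1), dCoeff q (k + 1) l * hallLittlewoodP q x l =
      ∑ ξ : Fin n → ℤˣ, Phi q (signPow x ξ) q 1 *
        ∏ i, x i ^ (((k + 1 : ℕ) : ℤ) * (1 - (ξ i : ℤ)) / 2) := by
  have hs := sum_signs_eq_conv (q := q) (s := q) (α := q) (β := 1) h0
    (fun i => by simp only [one_mul, and_self]) (k + 1) fun _ => True
  simp only [if_true, Finset.filter_true] at hs
  rw [hs, conv_twist_phiSet_eq hx h0 h1, conv_phiSet_inv_phiTail hx h0 h1 hp,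
    conv_levelConv_eq_sum, sum_hallLittlewoodP hq hx h0]
  · refine Finset.sum_congr rfl fun f _ => ?_
    congr 2
    simp only [dCoeff, prodOver, Finset.prod_const_one, one_mul]
    refine Finset.prod_congr rfl fun v _ => ?_
    refine (rogersSzego_neg_self_eq_div q fun i hi hi' => hq i hi (hi'.trans ?_)).symm
    exact (Finset.card_filter_le _ _).trans (by simp)
  · intro f σ
    simp only [dCoeff, mult_comp_perm]

theorem sum_cCoeff_hallLittlewoodP (k : ℕ) :
    ∑ l ∈ boundedConjEvenPartitions n (k + 1), cCoeff q (k + 1) l * hallLittlewoodP q x l =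
      ∑ ξ ∈ evenSigns n, Phi q (signPow x ξ) 0 0 *
        ∏ i, x i ^ (((k + 1 : ℕ) : ℤ) * (1 - (ξ i : ℤ)) / 2) := by
  classical
  have hn : ∀ i, 1 - x i ≠ 0 := fun i h => h1 i i (by rw [← sub_eq_zero.1 h, one_mul])
  have hn' : ∀ i, 1 - (x i)⁻¹ ≠ 0 := fun i h => h1 i i (by
    rw [inv_eq_one.1 (sub_eq_zero.1 h).symm, one_mul])
  -- At `s = 1` the single-variable factor of `phiSet` is (1 - x_i)/(1 - x_i), which equals 1 since
  -- x_i ≠ 1; this matches α = β = 0.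
  have hs := sum_signs_eq_conv (q := q) (s := 1) (α := 0) (β := 0) h0
    (fun i => by simp [div_self (hn i), div_self (hn' i)]) (k + 1) Even
  have hodd : ∀ U : Finset (Fin n), ¬ Even U.card → rsSet q 1 U = 0 := fun U hU =>
    rogersSzego_neg_one_of_not_even q hU
  change ∑ ξ ∈ evenSigns n, _ = conv _ (twist _ (evenPart _)) _ _ at hs
  rw [hs, conv_twist_phiSet_eq hx h0 h1, conv_evenPart _ (phiTail_eq_zero hx h0 h1 hp hodd),
    conv_phiSet_inv_phiTail hx h0 h1 hp, conv_levelConv_eq_sum]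
  rw [← sum_hallLittlewoodP hq hx h0 (k + 1) fun f =>
    evenPart (prodOver fun _ => 1) (univ.filter fun i => f i = k + 1) *
          ∏ v ∈ Ico 1 (k + 1), rsSet q 1 (univ.filter fun i => f i = v)]
  · rw [boundedConjEvenPartitions, Finset.sum_filter]
    refine Finset.sum_congr rfl fun l hl => ?_
    rw [even_conjPart_iff (mem_boundedPartitions.1 hl).2]
    split_ifs with h
    · congr 1
      have htop : Even (univ.filter fun i => l i = k + 1).card := h (k + 1) (by simp)
      rw [evenPart, if_pos htop, prodOver, Finset.prod_const_one, one_mul, cCoeff]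
      refine Finset.prod_congr rfl fun v hv => ?_
      rw [mem_Ico] at hv
      exact (rogersSzego_neg_one_of_even q (h v (mem_Ico.2 (by omega)))).symm
    -- An odd multiplicity makes the word coefficient vanish: through the even part at the top
    -- level, through `rsSet` at the levels between.
    · push Not at h
      obtain ⟨v, hv, hv'⟩ := h
      rw [mem_Ico] at hv
      by_cases hk : v = k + 1
      · subst hk
        have htop : ¬ Even (univ.filter fun i => l i = k + 1).card := hv'
        rw [evenPart, if_neg htop, zero_mul, zero_mul]
      · rw [Finset.prod_eq_zero (mem_Ico.2 (show 1 ≤ v ∧ v < k + 1 by omega)) (hodd _ hv'),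
          mul_zero, zero_mul]
  · intro f σ
    have hm : ∀ v, (univ.filter fun i => (f ∘ σ) i = v).card =
        (univ.filter fun i => f i = v).card := mult_comp_perm f σ
    simp only [evenPart, rsSet, hm, prodOver, Finset.prod_const_one]

end Generic

end Main

/-! ### Indeterminates satisfy the genericity conditions. -/

section Indeterminates

variable (F : Type*) [Field F] (n : ℕ)

theorem algebraMap_ratField_injective :
    Function.Injective (algebraMap (MvPolynomial (Fin n) F) (RatField F n)) :=
  IsFractionRing.injective _ _

theorem indet_injective : Function.Injective (indet F n) :=
  (algebraMap_ratField_injective F n).comp (MvPolynomial.X_injective (R := F))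

theorem indet_ne_zero (i : Fin n) : indet F n i ≠ 0 := by
  rw [indet, Ne, map_eq_zero_iff _ (algebraMap_ratField_injective F n)]
  exact MvPolynomial.X_ne_zero i

/-- Compare constant coefficients: a nonempty product of indeterminates has constant coefficient 0.
-/
theorem prodOver_indet_ne_one {U : Finset (Fin n)} (hU : U.Nonempty) :
    prodOver (indet F n) U ≠ 1 := by
  intro h
  simp only [prodOver, indet] at h
  rw [← map_prod, map_eq_one_iff _ (algebraMap_ratField_injective F n)] at h
  have h2 := congrArg MvPolynomial.constantCoeff h
  obtain ⟨i, hi⟩ := hU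
  rw [map_prod, map_one, Finset.prod_eq_zero hi (MvPolynomial.constantCoeff_X _ i)] at h2
  exact zero_ne_one h2

theorem indet_mul_indet_ne_one (i j : Fin n) : indet F n i * indet F n j ≠ 1 := by
  intro h
  rw [indet, indet, ← map_mul, map_eq_one_iff _ (algebraMap_ratField_injective F n)] at h
  have h2 := congrArg MvPolynomial.constantCoeff h
  simp at h2

theorem scalar_pow_ne_one {F : Type*} [Field F] {n : ℕ} {q : F} {m : ℕ} (h : q ^ m ≠ 1) :
    scalar n q ^ m ≠ 1 := by
  rw [scalar, ← map_pow, ← map_pow, Ne, map_eq_one_iff _ (algebraMap_ratField_injective F n),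
    map_eq_one_iff _ (MvPolynomial.C_injective _ _)]
  exact h

end Indeterminates

end HallLittlewood

theorem theorem1 {F : Type*} [Field F] (n k : ℕ) (hk : 1 ≤ k) (q : F)
    (hq : ∀ m : ℕ, 1 ≤ m → m ≤ n → q ^ m ≠ 1) :
    (∑ l ∈ HallLittlewood.boundedConjEvenPartitions n k,
        HallLittlewood.cCoeff (HallLittlewood.scalar n q) k l *
          HallLittlewood.hallLittlewoodP (HallLittlewood.scalar n q)
            (HallLittlewood.indet F n) l =
      ∑ ξ ∈ HallLittlewood.evenSigns n,
        HallLittlewood.Phi (HallLittlewood.scalar n q)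
            (HallLittlewood.signPow (HallLittlewood.indet F n) ξ) 0 0 *
          ∏ i, HallLittlewood.indet F n i ^ ((k : ℤ) * (1 - (ξ i : ℤ)) / 2)) ∧
    (∑ l ∈ HallLittlewood.boundedPartitions n k,
        HallLittlewood.dCoeff (HallLittlewood.scalar n q) k l *
          HallLittlewood.hallLittlewoodP (HallLittlewood.scalar n q)
            (HallLittlewood.indet F n) l =
      ∑ ξ : Fin n → ℤˣ,
        HallLittlewood.Phi (HallLittlewood.scalar n q)
            (HallLittlewood.signPow (HallLittlewood.indet F n) ξ)
            (HallLittlewood.scalar n q) 1 *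
          ∏ i, HallLittlewood.indet F n i ^ ((k : ℤ) * (1 - (ξ i : ℤ)) / 2)) := by
  -- The convolution form requires the top level `k` and the bottom level 0 to be different.
  obtain ⟨k, rfl⟩ : ∃ r, k = r + 1 := ⟨k - 1, by omega⟩
  have hq' : ∀ m : ℕ, 1 ≤ m → m ≤ n → HallLittlewood.scalar n q ^ m ≠ 1 := fun m h1 h2 =>
    HallLittlewood.scalar_pow_ne_one (hq m h1 h2)
  exact ⟨HallLittlewood.sum_cCoeff_hallLittlewoodP hq' (HallLittlewood.indet_injective F n)
      (HallLittlewood.indet_ne_zero F n) (HallLittlewood.indet_mul_indet_ne_one F n)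
      (fun _ => HallLittlewood.prodOver_indet_ne_one F n) k,
    HallLittlewood.sum_dCoeff_hallLittlewoodP hq' (HallLittlewood.indet_injective F n)
      (HallLittlewood.indet_ne_zero F n) (HallLittlewood.indet_mul_indet_ne_one F n)
      (fun _ => HallLittlewood.prodOver_indet_ne_one F n) k⟩
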